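/- Let $k$ be $\mathbb R$ or $\mathbb C$, let $V=k^9$, and let $$\mathfrak g_k=\mathfrak g_{0}\oplus\mathfrak g_{1}\oplus\mathfrak g_{-1},\qquad \mathfrak g_0=\mathfrak{sl}(9,k),\quad \mathfrak g_1=\textstyle\bigwedge^3V,\quad \mathfrak g_{-1}=\textstyle\bigwedge^3V^*,$$ be the split simple Lie algebra of type $E_8$ over $k$ with its $\mathbb Z/3\mathbb Z$-grading. Its bracket is given by the commutator on $\mathfrak{sl}(9,k)$, the natural actions of $\mathfrak{sl}(9,k)$ on $\bigwedge^3V$ and $\bigwedge^3V^*$, the maps $\bigwedge^3V\times\bigwedge^3V\to\bigwedge^6V\cong\bigwedge^3V^*$ and (with a minus sign) $\bigwedge^3V^*\times\bigwedge^3V^*\to\bigwedge^6V^*\cong\bigwedge^3V$ coming from the volume form, and the map $\bigwedge^3V\times\bigwedge^3V^*\to\mathfrak{sl}(9,k)$ that is dual, with respect to the trace form, to the action of $\mathfrak{sl}(9,k)$. Write $\mathfrak g=\mathfrak g_{\mathbb R}\subset\mathfrak g_{\mathbb C}$, and let $\mathrm{SL}(9,k)$ act on $\mathfrak g_k$ by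 conjugation on $\mathfrak{sl}(9,k)$, by the natural action on $\bigwedge^3V$ and by the dual action on $\bigwedge^3V^*$. Let $e\in\mathfrak g_1=\bigwedge^3\mathbb R^9$ be nilpotent (that is, $\operatorname{ad} e$ is nilpotent), and let $t=(h,e,f)$ be a real homogeneous $\mathfrak{sl}_2$-triple containing $e$: $h\in\mathfrak g_0$, $f\in\mathfrak g_{-1}$ (both real) and $[e,f]=h$, $[h,e]=2e$, $[h,f]=-2f$. Let $Z=Z_{\mathrm{SL}(9,\mathbb C)}(t)$ be the group of all $g\in\mathrm{SL}(9,\mathbb C)$ that fix $h$, $e$ and $f$; it is stable under complex conjugation. Let $$\mathrm H^1(\mathbb R,Z)=\{c\in Z: c\,\bar c=1\}/\!\sim,\qquad c\sim c' \iff c'=a^{-1}c\,\bar a\ \text{ for some } a\in Z .$$ Then the $\mathrm{SL}(9,\mathbb R)$-orbits in $(\mathrm{SL}(9,\mathbb C)\cdot e)\cap\mathfrak g_1$, where $\mathfrak g_1=\bigwedge^3\mathbb R^9$, are in (canonical) bijection with $\mathrm H^1(\mathbb R,Z)$. Explicitly, for every $c\in Z$ with $c\,\bar c=1$ there is $g\in\mathrm{SL}(9,\mathbb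 C)$ with $g^{-1}\bar g=c$; for each such $g$ the element $g\cdot e$ is real, and the bijection sends the class of $c$ to the orbit $\mathrm{SL}(9,\mathbb R)\cdot(g\cdot e)$. -/

import Mathlib

open Equiv (Perm)
open scoped MatrixGroups

set_option linter.unusedSectionVars false

/-!
The split simple Lie algebra of type `E₈` over a field of characteristic zero, with its
`ℤ/3`-grading `𝔤 = 𝔤₋₁ ⊕ 𝔤₀ ⊕ 𝔤₁`, in the explicit model
`𝔤₀ = 𝔰𝔩(9)`, `𝔤₁ = ⋀³ k⁹`, `𝔤₋₁ = ⋀³ (k⁹)*`.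

Trivectors are written as alternating tensors: the tensor `v` stands for
`(1/6) ∑ v i j l • e_i ∧ e_j ∧ e_l`, so that `e_a ∧ e_b ∧ e_c` (with `a`, `b`, `c` distinct)
has coordinate `sign π` at the permutation `π` of `(a, b, c)` and `0` elsewhere.
-/

namespace Trivector

section Tensors

/-- Tensors of order three on `k⁹`, in coordinates. -/
abbrev Tensor (k : Type*) := Fin 9 → Fin 9 → Fin 9 → k

variable {k : Type*} [Field k]

/-- Alternating tensors (in characteristic zero: antisymmetric ones). -/
def IsAlt (v : Tensor k) : Prop := ∀ i j l, v j i l = -v i j l ∧ v i l j = -v i j l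

/-- The action of a matrix `g` on tensors: `g • (a ⊗ b ⊗ c) = g a ⊗ g b ⊗ g c`. -/
def matAct (g : Matrix (Fin 9) (Fin 9) k) (v : Tensor k) : Tensor k := fun i j l =>
  ∑ p, ∑ q, ∑ r, g i p * g j q * g l r * v p q r

/-- The derived (Lie algebra) action:
`X • (a ⊗ b ⊗ c) = X a ⊗ b ⊗ c + a ⊗ X b ⊗ c + a ⊗ b ⊗ X c`. -/
def lieAct (X : Matrix (Fin 9) (Fin 9) k) (v : Tensor k) : Tensor k := fun i j l =>
  ∑ p, (X i p * v p j l + X j p * v i p l + X l p * v i j p)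

/-- The product `⋀³ V × ⋀³ V → ⋀⁶ V ≅ ⋀³ V*`, where the last isomorphism comes from the
volume form of `V = k⁹`: for alternating `v` and `w`, the `(i, j, l)` coordinate is the volume of
`e_i ∧ e_j ∧ e_l ∧ v ∧ w`. -/
def cross (v w : Tensor k) : Tensor k := fun i j l =>
  (1 / 36) * ∑ σ : Perm (Fin 9), if σ 0 = i ∧ σ 1 = j ∧ σ 2 = l then
    ((Perm.sign σ : ℤ) : k) * (v (σ 3) (σ 4) (σ 5) * w (σ 6) (σ 7) (σ 8)) else 0

/-- The contraction of `v ∈ ⋀³ V` and `w ∈ ⋀³ V*` in two indices. -/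
def contract (v w : Tensor k) : Matrix (Fin 9) (Fin 9) k := fun i j =>
  (1 / 2) * ∑ p, ∑ q, v i p q * w j p q

/-- The traceless part of a `9 × 9` matrix. -/
def traceless (M : Matrix (Fin 9) (Fin 9) k) : Matrix (Fin 9) (Fin 9) k :=
  M - (M.trace / 9) • 1

/-- The pairing `⋀³ V × ⋀³ V* → 𝔰𝔩(V)`. It is characterised by `tr (X * moment v w) = ⟨X • v, w⟩`
for traceless `X`, where `⟨e_a ∧ e_b ∧ e_c, e_a* ∧ e_b* ∧ e_c*⟩ = 1`. -/
def moment (v w : Tensor k) : Matrix (Fin 9) (Fin 9) k := traceless (contract v w)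

/-- Component in degree `0` of the bracket of `(A, a, α)` and `(B, b, β)`, where
`A, B ∈ 𝔰𝔩(V)`, `a, b ∈ ⋀³ V`, `α, β ∈ ⋀³ V*`. -/
def br0 (A B : Matrix (Fin 9) (Fin 9) k) (a b α β : Tensor k) : Matrix (Fin 9) (Fin 9) k :=
  A * B - B * A + moment a β - moment b α

/-- Component in degree `1` of the bracket of `(A, a, α)` and `(B, b, β)`. -/
def br1 (A B : Matrix (Fin 9) (Fin 9) k) (a b α β : Tensor k) : Tensor k :=
  lieAct A b - lieAct B a - cross α β

/-- Component in degree `-1` of the bracket of `(A, a, α)` and `(B, b, β)`; here `𝔰𝔩(V)` acts on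
`⋀³ V*` by the dual action, that is, through `X ↦ -Xᵀ`. -/
def brN (A B : Matrix (Fin 9) (Fin 9) k) (a b α β : Tensor k) : Tensor k :=
  lieAct (-A.transpose) β - lieAct (-B.transpose) α + cross a b

/-! Auxiliary facts, up to the Jacobi identity. -/

lemma isAlt_add {u v : Tensor k} (hu : IsAlt u) (hv : IsAlt v) : IsAlt (u + v) := by
  intro i j l
  simp only [Pi.add_apply, (hu i j l).1, (hu i j l).2, (hv i j l).1, (hv i j l).2]
  constructor <;> ring

lemma isAlt_smul (c : k) {v : Tensor k} (hv : IsAlt v) : IsAlt (c • v) := by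
  intro i j l
  simp only [Pi.smul_apply, (hv i j l).1, (hv i j l).2, smul_neg, and_self]

lemma isAlt_zero : IsAlt (0 : Tensor k) := fun _ _ _ => by simp

lemma isAlt_matAct (g : Matrix (Fin 9) (Fin 9) k) {v : Tensor k} (hv : IsAlt v) :
    IsAlt (matAct g v) := by
  intro i j l
  simp only [matAct, ← Finset.sum_neg_distrib]
  constructor
  · rw [Finset.sum_comm]
    refine Finset.sum_congr rfl fun p _ => Finset.sum_congr rfl fun q _ =>
      Finset.sum_congr rfl fun r _ => ?_
    rw [(hv p q r).1]; ring
  · refine Finset.sum_congr rfl fun p _ => ?_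
    rw [Finset.sum_comm]
    refine Finset.sum_congr rfl fun q _ => Finset.sum_congr rfl fun r _ => ?_
    rw [(hv p q r).2]; ring

lemma matAct_one (v : Tensor k) : matAct 1 v = v := by
  funext i j l
  simp [matAct, Matrix.one_apply]

lemma matAct_mul (g h : Matrix (Fin 9) (Fin 9) k) (v : Tensor k) :
    matAct (g * h) v = matAct g (matAct h v) := by
  have step : ∀ (g : Matrix (Fin 9) (Fin 9) k) (v : Tensor k) (i j l), matAct g v i j l =
      ∑ p, g i p * ∑ q, g j q * ∑ r, g l r * v p q r := by
    intro g v i j l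
    simp only [matAct, Finset.mul_sum]
    exact Finset.sum_congr rfl fun _ _ => Finset.sum_congr rfl fun _ _ =>
      Finset.sum_congr rfl fun _ _ => by ring
  have comp : ∀ (i : Fin 9) (f : Fin 9 → k),
      ∑ p, (g * h) i p * f p = ∑ x, g i x * ∑ p, h x p * f p := by
    intro i f
    simp only [Matrix.mul_apply, Finset.sum_mul, Finset.mul_sum]
    rw [Finset.sum_comm]
    exact Finset.sum_congr rfl fun _ _ => Finset.sum_congr rfl fun _ _ => by ring
  have swap : ∀ (M N : Matrix (Fin 9) (Fin 9) k) (i j : Fin 9) (f : Fin 9 → Fin 9 → k),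
      ∑ p, M i p * ∑ q, N j q * f p q = ∑ q, N j q * ∑ p, M i p * f p q := by
    intro M N i j f
    simp only [Finset.mul_sum]
    rw [Finset.sum_comm]
    exact Finset.sum_congr rfl fun _ _ => Finset.sum_congr rfl fun _ _ => by ring
  funext i j l
  simp only [step, comp]
  refine Finset.sum_congr rfl fun x _ => ?_
  congr 1
  rw [swap h g]
  refine Finset.sum_congr rfl fun y _ => ?_
  congr 1
  simp only [swap h g]

variable [CharZero k]

/-- The sum of the products of all coordinates. -/
def pair (u v : Tensor k) : k := ∑ i, ∑ j, ∑ l, u i j l * v i j l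

/-- The volume of `u ⊗ v ⊗ w`, up to a constant. -/
def vol (u v w : Tensor k) : k := ∑ σ : Perm (Fin 9), ((Perm.sign σ : ℤ) : k) *
  (u (σ 0) (σ 1) (σ 2) * v (σ 3) (σ 4) (σ 5) * w (σ 6) (σ 7) (σ 8))

lemma pair_cross (u v w : Tensor k) : pair u (cross v w) = (1 / 36) * vol u v w := by
  unfold pair cross vol
  simp only [Finset.mul_sum]
  calc _ = ∑ σ : Perm (Fin 9), ∑ i, ∑ j, ∑ l, (if σ 0 = i then if σ 1 = j then if σ 2 = l then
        (1/36 : k) * (((Perm.sign σ : ℤ) : k) *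
          (u i j l * v (σ 3) (σ 4) (σ 5) * w (σ 6) (σ 7) (σ 8))) else 0 else 0 else 0) := by
        rw [Finset.sum_comm]
        simp only [Finset.sum_comm (s := (Finset.univ : Finset (Perm (Fin 9))))]
        rw [Finset.sum_comm]
        refine Finset.sum_congr rfl fun i _ => Finset.sum_congr rfl fun j _ =>
          Finset.sum_congr rfl fun l _ => Finset.sum_congr rfl fun σ _ => ?_
        by_cases h0 : σ 0 = i <;> by_cases h1 : σ 1 = j <;> by_cases h2 : σ 2 = l <;>
          simp [h0, h1, h2]; ring
    _ = _ := by simp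

lemma pair_eq_zero {D : Tensor k} (h : ∀ u, pair u D = 0) : D = 0 := by
  funext i j l
  have := h (Pi.single i (Pi.single j (Pi.single l 1)))
  unfold pair at this
  rw [Finset.sum_eq_single i (by intro b _ hb; simp [hb]) (by simp)] at this
  rw [Finset.sum_eq_single j (by intro b _ hb; simp [hb]) (by simp)] at this
  rw [Finset.sum_eq_single l (by intro b _ hb; simp [hb]) (by simp)] at this
  simpa using this

lemma pair_add (u v w : Tensor k) : pair u (v + w) = pair u v + pair u w := by
  simp [pair, mul_add, Finset.sum_add_distrib]
lemma pair_sub (u v w : Tensor k) : pair u (v - w) = pair u v - pair u w := by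
  simp [pair, mul_sub, Finset.sum_sub_distrib]
lemma pair_smul (c : k) (u v : Tensor k) : pair u (c • v) = c * pair u v := by
  simp [pair, Finset.mul_sum, mul_left_comm]
lemma pair_comm (u v : Tensor k) : pair u v = pair v u := by
  simp [pair, mul_comm]

lemma pair_lieAct (X : Matrix (Fin 9) (Fin 9) k) (u v : Tensor k) :
    pair u (lieAct X v) = pair (lieAct X.transpose u) v := by
  simp only [pair, lieAct, Finset.mul_sum, Finset.sum_mul, mul_add, add_mul,
    Finset.sum_add_distrib, Matrix.transpose_apply]
  congr 1
  · congr 1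
    · calc _ = ∑ j, ∑ l, ∑ i, ∑ p, u i j l * (X i p * v p j l) := by
            rw [Finset.sum_comm]; refine Finset.sum_congr rfl fun j _ => ?_
            rw [Finset.sum_comm]
        _ = ∑ j, ∑ l, ∑ i, ∑ p, X p i * u p j l * v i j l := by
            refine Finset.sum_congr rfl fun j _ => Finset.sum_congr rfl fun l _ => ?_
            rw [Finset.sum_comm]
            exact Finset.sum_congr rfl fun j _ => Finset.sum_congr rfl fun l _ => by ring
        _ = _ := by
            symm
            rw [Finset.sum_comm]; refine Finset.sum_congr rfl fun j _ => ?_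
            rw [Finset.sum_comm]
    · refine Finset.sum_congr rfl fun i _ => ?_
      calc _ = ∑ l, ∑ j, ∑ p, u i j l * (X j p * v i p l) := by
            rw [Finset.sum_comm]
        _ = ∑ l, ∑ j, ∑ p, X p j * u i p l * v i j l := by
            refine Finset.sum_congr rfl fun j _ => ?_
            rw [Finset.sum_comm]
            exact Finset.sum_congr rfl fun j _ => Finset.sum_congr rfl fun l _ => by ring
        _ = _ := by
            rw [Finset.sum_comm]
  · refine Finset.sum_congr rfl fun i _ => Finset.sum_congr rfl fun j _ => ?_
    rw [Finset.sum_comm]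
    exact Finset.sum_congr rfl fun j _ => Finset.sum_congr rfl fun l _ => by ring

lemma sum_sign_update (X : Matrix (Fin 9) (Fin 9) k) (F : (Fin 9 → Fin 9) → k) :
    ∑ σ : Perm (Fin 9), ((Perm.sign σ : ℤ) : k) *
      ∑ n, ∑ p, X (σ n) p * F (Function.update σ n p) =
    X.trace * ∑ σ : Perm (Fin 9), ((Perm.sign σ : ℤ) : k) * F σ := by
  have h1 : ∀ σ : Perm (Fin 9), ∑ n, ∑ p, X (σ n) p * F (Function.update σ n p) =
      ∑ n, ∑ m, X (σ n) (σ m) * F (Function.update σ n (σ m)) := fun σ =>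
    Finset.sum_congr rfl fun n _ =>
      (Equiv.sum_comp σ (fun p => X (σ n) p * F (Function.update σ n p))).symm
  have h2 : ∀ n m : Fin 9, n ≠ m → ∑ σ : Perm (Fin 9), ((Perm.sign σ : ℤ) : k) *
      (X (σ n) (σ m) * F (Function.update σ n (σ m))) = 
      - ∑ σ : Perm (Fin 9), ((Perm.sign σ : ℤ) : k) *
      (X (σ m) (σ n) * F (Function.update σ m (σ n))) := by
    intro n m hnm
    rw [← Equiv.sum_comp (Equiv.mulRight (Equiv.swap n m)), ← Finset.sum_neg_distrib]
    refine Finset.sum_congr rfl fun σ _ => ?_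
    have : Function.update (⇑(σ * Equiv.swap n m)) n ((σ * Equiv.swap n m) m) =
        Function.update σ m (σ n) := by
      funext x
      by_cases hx : x = n
      · subst hx; simp [hnm]
      · by_cases hx' : x = m
        · subst hx'; simp [hx]
        · simp [hx, hx', Equiv.swap_apply_of_ne_of_ne hx hx']
    simp only [Equiv.coe_mulRight]
    rw [this]
    simp [Perm.sign_mul, Perm.sign_swap hnm]
  simp only [h1, Finset.mul_sum]
  have h3 : ∀ (n : Fin 9) (σ : Perm (Fin 9)), ∑ m, ((Perm.sign σ : ℤ) : k) *
        (X (σ n) (σ m) * F (Function.update σ n (σ m))) =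
      ((Perm.sign σ : ℤ) : k) * (X (σ n) (σ n) * F σ) +
      ∑ m, if n ≠ m then ((Perm.sign σ : ℤ) : k) *
        (X (σ n) (σ m) * F (Function.update σ n (σ m))) else 0 := by
    intro n σ
    rw [← Finset.add_sum_erase _ _ (Finset.mem_univ n),
      ← Finset.add_sum_erase _ (fun m => if n ≠ m then _ else _) (Finset.mem_univ n)]
    simp only [Function.update_eq_self, ne_eq, not_true_eq_false, if_false, zero_add]
    congr 1
    refine Finset.sum_congr rfl fun m hm => ?_
    rw [if_pos (Finset.ne_of_mem_erase hm).symm]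
  simp only [h3, Finset.sum_add_distrib]
  have h4 : ∑ σ : Perm (Fin 9), ∑ n, ∑ m, (if n ≠ m then ((Perm.sign σ : ℤ) : k) *
        (X (σ n) (σ m) * F (Function.update σ n (σ m))) else 0) = 0 := by
    rw [Finset.sum_comm]
    simp only [Finset.sum_comm (s := (Finset.univ : Finset (Perm (Fin 9))))]
    set S := ∑ n : Fin 9, ∑ m : Fin 9, ∑ σ : Perm (Fin 9),
      (if n ≠ m then ((Perm.sign σ : ℤ) : k) *
        (X (σ n) (σ m) * F (Function.update σ n (σ m))) else 0) with hS
    have : S = -S := by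
      conv_rhs => rw [hS, Finset.sum_comm]
      rw [hS, ← Finset.sum_neg_distrib]
      refine Finset.sum_congr rfl fun n _ => ?_
      rw [← Finset.sum_neg_distrib]
      refine Finset.sum_congr rfl fun m _ => ?_
      by_cases hnm : n = m
      · simp [hnm]
      · simp only [ne_eq, hnm, Ne.symm hnm, not_false_eq_true, if_true]
        exact h2 n m hnm
    exact self_eq_neg.mp this
  rw [h4, add_zero]
  refine Finset.sum_congr rfl fun σ _ => ?_
  rw [← Finset.mul_sum, ← Finset.sum_mul, Equiv.sum_comp σ (fun n => X n n), Matrix.trace]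
  simp only [Matrix.diag_apply]
  ring

lemma vol_lieAct (X : Matrix (Fin 9) (Fin 9) k) (u v w : Tensor k) :
    vol (lieAct X u) v w + vol u (lieAct X v) w + vol u v (lieAct X w) =
      X.trace * vol u v w := by
  have := sum_sign_update X
    (fun f => u (f 0) (f 1) (f 2) * v (f 3) (f 4) (f 5) * w (f 6) (f 7) (f 8))
  unfold vol
  rw [← this, ← Finset.sum_add_distrib, ← Finset.sum_add_distrib]
  refine Finset.sum_congr rfl fun σ _ => ?_
  rw [← mul_add, ← mul_add]
  congr 1
  have hu : ∀ n : Fin 9, ∀ p, ∀ x, Function.update σ n p x = if x = n then p else σ x :=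
    fun n p x => Function.update_apply ..
  rw [show ∀ G : Fin 9 → k, ∑ n, G n = G 0 + G 1 + G 2 + G 3 + G 4 + G 5 + G 6 + G 7 + G 8 from
    fun G => by simp [Fin.sum_univ_succ]; ring]
  simp only [hu, lieAct, Finset.sum_mul, Finset.mul_sum, ← Finset.sum_add_distrib]
  refine Finset.sum_congr rfl fun p _ => ?_
  simp only [Fin.reduceEq, if_true, if_false]
  ring

lemma vol_rotate (u v w : Tensor k) : vol u v w = vol v w u := by
  unfold vol
  let r : Perm (Fin 9) := finRotate 9 ^ 6
  have hs : Perm.sign r = 1 := by simp only [r, map_pow, sign_finRotate]; norm_num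
  rw [← Equiv.sum_comp (Equiv.mulRight r)]
  refine Finset.sum_congr rfl fun σ _ => ?_
  simp only [Equiv.coe_mulRight, Perm.sign_mul, hs, mul_one, Perm.mul_apply]
  have e : ∀ i, r i = i + 6 := by intro i; simp [r]; revert i; decide
  simp only [e, Fin.reduceAdd]
  ring_nf

lemma cross_lieAct (X : Matrix (Fin 9) (Fin 9) k) (hX : X.trace = 0) (v w : Tensor k) :
    cross (lieAct X v) w + cross v (lieAct X w) = lieAct (-X.transpose) (cross v w) := by
  rw [← sub_eq_zero]
  apply pair_eq_zero
  intro u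
  have hn : ∀ Y : Matrix (Fin 9) (Fin 9) k, pair (lieAct (-Y) u) (cross v w) =
      - pair (lieAct Y u) (cross v w) := by
    intro Y
    simp only [pair, lieAct, Finset.sum_mul, ← Finset.sum_neg_distrib, Matrix.neg_apply]
    refine Finset.sum_congr rfl fun i _ => Finset.sum_congr rfl fun j _ =>
      Finset.sum_congr rfl fun l _ => Finset.sum_congr rfl fun p _ => ?_
    ring
  rw [pair_sub, pair_add, pair_lieAct, Matrix.transpose_neg, Matrix.transpose_transpose, hn]
  simp only [pair_cross]
  have := vol_lieAct X u v w
  rw [hX] at this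
  linear_combination (1/36 : k) * this

lemma contract_lieAct (X : Matrix (Fin 9) (Fin 9) k) (v w : Tensor k) :
    contract (lieAct X v) w + contract v (lieAct (-X.transpose) w) =
      X * contract v w - contract v w * X := by
  ext i j
  have e1 : ∑ p, ∑ q, ∑ r, X p r * v i r q * w j p q =
      ∑ p, ∑ q, ∑ r, v i p q * X r p * w j r q := by
    rw [Finset.sum_comm]
    conv_rhs => rw [Finset.sum_comm]
    refine Finset.sum_congr rfl fun q _ => ?_
    rw [Finset.sum_comm]
    exact Finset.sum_congr rfl fun _ _ => Finset.sum_congr rfl fun _ _ => by ring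
  have e2 : ∑ p, ∑ q, ∑ r, X q r * v i p r * w j p q =
      ∑ p, ∑ q, ∑ r, v i p q * X r q * w j p r := by
    refine Finset.sum_congr rfl fun q _ => ?_
    rw [Finset.sum_comm]
    exact Finset.sum_congr rfl fun _ _ => Finset.sum_congr rfl fun _ _ => by ring
  have e3 : (X * contract v w) i j = (1/2) * ∑ p, ∑ q, ∑ r, X i r * v r p q * w j p q := by
    simp only [Matrix.mul_apply, contract, Finset.mul_sum]
    rw [Finset.sum_comm]
    refine Finset.sum_congr rfl fun q _ => ?_
    rw [Finset.sum_comm]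
    exact Finset.sum_congr rfl fun _ _ => Finset.sum_congr rfl fun _ _ => by ring
  have e4 : (contract v w * X) i j = (1/2) * ∑ p, ∑ q, ∑ r, v i p q * X r j * w r p q := by
    simp only [Matrix.mul_apply, contract, Finset.mul_sum, Finset.sum_mul]
    rw [Finset.sum_comm]
    refine Finset.sum_congr rfl fun q _ => ?_
    rw [Finset.sum_comm]
    exact Finset.sum_congr rfl fun _ _ => Finset.sum_congr rfl fun _ _ => by ring
  have e5 : contract (lieAct X v) w i j = (1/2) * (∑ p, ∑ q, ∑ r, X i r * v r p q * w j p q +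
      ∑ p, ∑ q, ∑ r, X p r * v i r q * w j p q + ∑ p, ∑ q, ∑ r, X q r * v i p r * w j p q) := by
    simp only [contract, lieAct, Finset.sum_mul, add_mul, Finset.sum_add_distrib]
  have e6 : contract v (lieAct (-X.transpose) w) i j =
      -(1/2) * (∑ p, ∑ q, ∑ r, v i p q * X r j * w r p q +
      ∑ p, ∑ q, ∑ r, v i p q * X r p * w j r q + ∑ p, ∑ q, ∑ r, v i p q * X r q * w j p r) := by
    rw [neg_mul, ← mul_neg]
    simp only [contract, lieAct, Finset.mul_sum, Matrix.neg_apply, Matrix.transpose_apply,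
      ← Finset.sum_add_distrib, ← Finset.sum_neg_distrib]
    refine Finset.sum_congr rfl fun p _ => Finset.sum_congr rfl fun q _ =>
      Finset.sum_congr rfl fun r _ => ?_
    ring
  rw [Matrix.sub_apply, Matrix.add_apply, e3, e4, e5, e6, e1, e2]
  ring

lemma lieAct_lieAct (X Y : Matrix (Fin 9) (Fin 9) k) (v : Tensor k) :
    lieAct (X * Y - Y * X) v = lieAct X (lieAct Y v) - lieAct Y (lieAct X v) := by
  have key : ∀ X Y : Matrix (Fin 9) (Fin 9) k, ∀ i j l, lieAct X (lieAct Y v) i j l =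
      lieAct (X * Y) v i j l + ∑ p, ∑ q, ((X i p * Y j q + Y i p * X j q) * v p q l +
        (X i p * Y l q + Y i p * X l q) * v p j q +
        (X j p * Y l q + Y j p * X l q) * v i p q) := by
    intro X Y i j l
    have hs : ∀ F : Fin 9 → Fin 9 → k, ∑ p, ∑ q, F p q = ∑ p, ∑ q, F q p := fun F =>
      Finset.sum_comm
    simp only [lieAct, Matrix.mul_apply, Finset.sum_mul, Finset.mul_sum, mul_add, add_mul,
      Finset.sum_add_distrib]
    rw [hs fun p q => X i q * Y q p * v p j l, hs fun p q => X j q * Y q p * v i p l,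
      hs fun p q => X l q * Y q p * v i j p, hs fun p q => X j p * (Y i q * v q p l),
      hs fun p q => X l p * (Y i q * v q j p), hs fun p q => X l p * (Y j q * v i q p)]
    simp only [← Finset.sum_add_distrib]
    exact Finset.sum_congr rfl fun _ _ => Finset.sum_congr rfl fun _ _ => by ring
  have sub : ∀ X Y : Matrix (Fin 9) (Fin 9) k, lieAct (X - Y) v = lieAct X v - lieAct Y v := by
    intro X Y
    funext i j l
    simp only [lieAct, Pi.sub_apply, Matrix.sub_apply, ← Finset.sum_sub_distrib]
    exact Finset.sum_congr rfl fun _ _ => by ring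
  rw [sub]
  funext i j l
  simp only [Pi.sub_apply, key X Y, key Y X]
  have : ∀ a b c d : k, c = d → a - b = a + c - (b + d) := by intro a b c d h; rw [h]; ring
  apply this
  exact Finset.sum_congr rfl fun _ _ => Finset.sum_congr rfl fun _ _ => by ring

lemma pair_lieAct_contract (X : Matrix (Fin 9) (Fin 9) k) (v w : Tensor k) (hv : IsAlt v)
    (hw : IsAlt w) : pair w (lieAct X v) = 6 * (X * contract v w).trace := by
  have e0 : (X * contract v w).trace =
      (1/2) * ∑ i, ∑ j, ∑ l, ∑ p, w i j l * (X i p * v p j l) := by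
    simp only [Matrix.trace, Matrix.diag_apply, Matrix.mul_apply, contract, Finset.mul_sum]
    refine Finset.sum_congr rfl fun i _ => ?_
    rw [Finset.sum_comm]
    refine Finset.sum_congr rfl fun j _ => ?_
    rw [Finset.sum_comm]
    exact Finset.sum_congr rfl fun _ _ => Finset.sum_congr rfl fun _ _ => by ring
  have e1 : pair w (lieAct X v) = ∑ i, ∑ j, ∑ l, ∑ p, w i j l * (X i p * v p j l) +
      ∑ i, ∑ j, ∑ l, ∑ p, w i j l * (X j p * v i p l) +
      ∑ i, ∑ j, ∑ l, ∑ p, w i j l * (X l p * v i j p) := by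
    simp only [pair, lieAct, Finset.mul_sum, mul_add, Finset.sum_add_distrib]
  have e2 : ∑ i, ∑ j, ∑ l, ∑ p, w i j l * (X j p * v i p l) =
      ∑ i, ∑ j, ∑ l, ∑ p, w i j l * (X i p * v p j l) := by
    rw [Finset.sum_comm]
    refine Finset.sum_congr rfl fun i _ => Finset.sum_congr rfl fun j _ =>
      Finset.sum_congr rfl fun l _ => Finset.sum_congr rfl fun p _ => ?_
    rw [(hw i j l).1, (hv p j l).1]; ring
  have e3 : ∑ i, ∑ j, ∑ l, ∑ p, w i j l * (X l p * v i j p) =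
      ∑ i, ∑ j, ∑ l, ∑ p, w i j l * (X j p * v i p l) := by
    refine Finset.sum_congr rfl fun i _ => ?_
    rw [Finset.sum_comm]
    refine Finset.sum_congr rfl fun j _ =>
      Finset.sum_congr rfl fun l _ => Finset.sum_congr rfl fun p _ => ?_
    rw [(hw i j l).2, (hv i p l).2]; ring
  rw [e1, e3, e2, e0]
  ring

lemma eq_smul_one_of_trace (M : Matrix (Fin 9) (Fin 9) k) (c : k)
    (h : ∀ X : Matrix (Fin 9) (Fin 9) k, (X * M).trace = X.trace * c) : M = c • 1 := by
  ext i j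
  have := h (Matrix.single j i 1)
  rw [Matrix.trace_single_mul] at this
  by_cases hij : i = j
  · subst hij; simpa using this
  · simpa [hij, Matrix.trace_single_eq_of_ne _ _ _ (Ne.symm hij)] using this

lemma isAlt_cross (v w : Tensor k) : IsAlt (cross v w) := by
  intro i j l
  unfold cross
  constructor
  · rw [← mul_neg, ← Finset.sum_neg_distrib, ← Equiv.sum_comp (Equiv.mulRight (Equiv.swap 0 1))]
    congr 1
    refine Finset.sum_congr rfl fun σ _ => ?_
    simp only [Equiv.coe_mulRight, Perm.sign_mul, Perm.mul_apply,
      Perm.sign_swap (show (0 : Fin 9) ≠ 1 by decide), Equiv.swap_apply_left,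
      Equiv.swap_apply_right]
    simp only [Equiv.swap_apply_def, Fin.reduceEq, if_false]
    by_cases h0 : σ 0 = i <;> by_cases h1 : σ 1 = j <;> by_cases h2 : σ 2 = l <;>
      simp [h0, h1, h2]
  · rw [← mul_neg, ← Finset.sum_neg_distrib, ← Equiv.sum_comp (Equiv.mulRight (Equiv.swap 1 2))]
    congr 1
    refine Finset.sum_congr rfl fun σ _ => ?_
    simp only [Equiv.coe_mulRight, Perm.sign_mul, Perm.mul_apply,
      Perm.sign_swap (show (1 : Fin 9) ≠ 2 by decide), Equiv.swap_apply_left,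
      Equiv.swap_apply_right]
    simp only [Equiv.swap_apply_def, Fin.reduceEq, if_false]
    by_cases h0 : σ 0 = i <;> by_cases h1 : σ 1 = j <;> by_cases h2 : σ 2 = l <;>
      simp [h0, h1, h2]

lemma contract_cyclic (u v w : Tensor k) (hu : IsAlt u) (hv : IsAlt v) (hw : IsAlt w) :
    contract u (cross v w) + contract v (cross w u) + contract w (cross u v) =
      ((1 / 216) * vol u v w) • (1 : Matrix (Fin 9) (Fin 9) k) := by
  apply eq_smul_one_of_trace
  intro X
  have h1 := pair_lieAct_contract X u _ hu (isAlt_cross v w)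
  have h2 := pair_lieAct_contract X v _ hv (isAlt_cross w u)
  have h3 := pair_lieAct_contract X w _ hw (isAlt_cross u v)
  rw [pair_comm, pair_cross] at h1 h2 h3
  have h4 := vol_lieAct X u v w
  rw [vol_rotate] at h3
  rw [← vol_rotate] at h2
  simp only [mul_add, Matrix.trace_add]
  linear_combination (1/216 : k) * h4 - (1/6 : k) * (h1 + h2 + h3)

def tens (a b c : Fin 9 → k) : Tensor k := fun i j l => a i * b j * c l

def wedge (a b c : Fin 9 → k) : Tensor k :=
  tens a b c - tens b a c - tens a c b - tens c b a + tens b c a + tens c a b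

lemma isAlt_wedge (a b c : Fin 9 → k) : IsAlt (wedge a b c) := by
  intro i j l
  simp only [wedge, tens, Pi.add_apply, Pi.sub_apply]
  constructor <;> ring

lemma cross_tens (a b : Fin 3 → Fin 9 → k) (i j l : Fin 9) :
    cross (tens (a 0) (a 1) (a 2)) (tens (b 0) (b 1) (b 2)) i j l =
      (1/36) * Matrix.det (Matrix.of ![Pi.single i 1, Pi.single j 1, Pi.single l 1, a 0, a 1, a 2, b 0, b 1, b 2]) := by
  rw [← Matrix.det_transpose, Matrix.det_apply']
  simp only [cross, tens]
  congr 1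
  refine Finset.sum_congr rfl fun σ _ => ?_
  rw [show ∀ G : Fin 9 → k, ∏ n, G n = G 0 * G 1 * G 2 * G 3 * G 4 * G 5 * G 6 * G 7 * G 8 from
    fun G => by simp [Fin.prod_univ_succ]; ring]
  by_cases h0 : σ 0 = i <;> by_cases h1 : σ 1 = j <;> by_cases h2 : σ 2 = l <;>
      simp [h0, h1, h2]
  ring

lemma cross_swap34 (v w : Tensor k) : cross (fun i j l => v j i l) w = -cross v w := by
  funext i j l
  simp only [cross, Pi.neg_apply]
  rw [← mul_neg, ← Finset.sum_neg_distrib, ← Equiv.sum_comp (Equiv.mulRight (Equiv.swap 3 4))]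
  congr 1
  refine Finset.sum_congr rfl fun σ _ => ?_
  simp only [Equiv.coe_mulRight, Perm.sign_mul, Perm.mul_apply,
    Perm.sign_swap (show (3 : Fin 9) ≠ 4 by decide), Equiv.swap_apply_def, Fin.reduceEq, if_false,
    if_true]
  split_ifs <;> simp

lemma cross_swap45 (v w : Tensor k) : cross (fun i j l => v i l j) w = -cross v w := by
  funext i j l
  simp only [cross, Pi.neg_apply]
  rw [← mul_neg, ← Finset.sum_neg_distrib, ← Equiv.sum_comp (Equiv.mulRight (Equiv.swap 4 5))]
  congr 1
  refine Finset.sum_congr rfl fun σ _ => ?_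
  simp only [Equiv.coe_mulRight, Perm.sign_mul, Perm.mul_apply,
    Perm.sign_swap (show (4 : Fin 9) ≠ 5 by decide), Equiv.swap_apply_def, Fin.reduceEq, if_false,
    if_true]
  split_ifs <;> simp

lemma cross_comm (v w : Tensor k) : cross w v = -cross v w := by
  rw [← sub_eq_zero]
  apply pair_eq_zero
  intro u
  rw [pair_sub, show -cross v w = (-1 : k) • cross v w by simp, pair_smul, pair_cross, pair_cross]
  have : vol u w v = - vol u v w := by
    unfold vol
    rw [← Finset.sum_neg_distrib, ← Equiv.sum_comp (Equiv.mulRight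
      (Equiv.swap 3 6 * Equiv.swap 4 7 * Equiv.swap 5 8))]
    refine Finset.sum_congr rfl fun σ _ => ?_
    simp only [Equiv.coe_mulRight, Perm.sign_mul, Perm.mul_apply,
      Perm.sign_swap (show (3 : Fin 9) ≠ 6 by decide), 
      Perm.sign_swap (show (4 : Fin 9) ≠ 7 by decide),
      Perm.sign_swap (show (5 : Fin 9) ≠ 8 by decide), Equiv.swap_apply_def, Fin.reduceEq, if_false,
      if_true]
    push_cast
    ring
  rw [this]; ring

lemma cross_add (u v w : Tensor k) : cross (u + v) w = cross u w + cross v w := by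
  funext i j l
  simp only [cross, Pi.add_apply, Finset.mul_sum, ← Finset.sum_add_distrib]
  refine Finset.sum_congr rfl fun σ _ => ?_
  split_ifs <;> ring

lemma cross_smul (c : k) (v w : Tensor k) : cross (c • v) w = c • cross v w := by
  funext i j l
  simp only [cross, Pi.smul_apply, smul_eq_mul, Finset.mul_sum]
  refine Finset.sum_congr rfl fun σ _ => ?_
  split_ifs <;> ring

lemma cross_wedge (a b c : Fin 9 → k) (w : Tensor k) :
    cross (wedge a b c) w = (6 : k) • cross (tens a b c) w := by
  have h1 : ∀ a b c : Fin 9 → k, cross (tens b a c) w = -cross (tens a b c) w := by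
    intro a b c
    rw [← cross_swap34]
    congr 1
    funext i j l; simp only [tens]; ring
  have h2 : ∀ a b c : Fin 9 → k, cross (tens a c b) w = -cross (tens a b c) w := by
    intro a b c
    rw [← cross_swap45]
    congr 1
    funext i j l; simp only [tens]; ring
  have e : wedge a b c = tens a b c + (-1 : k) • tens b a c + (-1 : k) • tens a c b
      + (-1 : k) • tens c b a + tens b c a + tens c a b := by
    simp only [wedge, neg_one_smul]; abel
  rw [e]
  simp only [cross_add, cross_smul]
  rw [h1 b c a, h2 b a c, h1 a c b, h2 a b c, h1 a b c, neg_neg]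
  module

lemma cross_wedge_wedge (a b c d e f : Fin 9 → k) :
    cross (wedge a b c) (wedge d e f) = (36 : k) • cross (tens a b c) (tens d e f) := by
  rw [cross_wedge, cross_comm, cross_wedge, cross_comm, smul_neg]
  module

lemma sum_perm_tail (Φ : (Fin 6 → Fin 9) → k) (hΦ : ∀ g, ¬ Function.Injective g → Φ g = 0) :
    ∑ σ : Perm (Fin 9), Φ (fun n => σ (Fin.natAdd 3 n)) = 6 * ∑ g, Φ g := by
  classical
  rw [← Finset.sum_fiberwise (s := Finset.univ)
    (g := fun σ : Perm (Fin 9) => fun n : Fin 6 => σ (Fin.natAdd 3 n)), Finset.mul_sum]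
  refine Finset.sum_congr rfl fun g _ => ?_
  rw [Finset.sum_congr rfl (g := fun _ => Φ g) (by intro σ hσ; rw [(Finset.mem_filter.mp hσ).2]),
    Finset.sum_const, nsmul_eq_mul]
  by_cases hg : Function.Injective g
  swap
  · rw [hΦ g hg]; simp
  congr 1
  have := Equiv.Perm.isMultiplyPretransitive (Fin 9) 6
  obtain ⟨σ₀, hσ₀⟩ := MulAction.IsPretransitive.exists_smul_eq (M := Perm (Fin 9))
    (⟨Fin.natAdd 3, Fin.natAdd_injective 6 3⟩ : Fin 6 ↪ Fin 9) ⟨g, hg⟩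
  have hσ : ∀ n, σ₀ (Fin.natAdd 3 n) = g n := fun n => DFunLike.congr_fun hσ₀ n
  have e : {σ : Perm (Fin 9) // (fun n : Fin 6 => σ (Fin.natAdd 3 n)) = g} ≃
      Perm {x : Fin 9 // x < 3} :=
    Equiv.trans
      { toFun := fun σ => ⟨σ₀⁻¹ * σ.1, fun a ha => by
          obtain ⟨n, rfl⟩ : ∃ n : Fin 6, Fin.natAdd 3 n = a := by
            revert ha; revert a; decide
          have h : σ.1 (Fin.natAdd 3 n) = g n := congrFun σ.2 n
          rw [Perm.mul_apply, h, ← hσ]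
          exact σ₀.symm_apply_apply _⟩
        invFun := fun ρ => ⟨σ₀ * ρ.1, by
          funext n
          rw [Perm.mul_apply, ρ.2 _ (by revert n; decide), hσ]⟩
        left_inv := fun σ => Subtype.ext (mul_inv_cancel_left _ _)
        right_inv := fun ρ => Subtype.ext (inv_mul_cancel_left _ _) }
      (Perm.subtypeEquivSubtypePerm (fun x : Fin 9 => x < 3)).symm
  rw [← Fintype.card_subtype, Fintype.card_congr e, Fintype.card_perm]
  have : Fintype.card {x : Fin 9 // x < 3} = 3 := by decide
  rw [this]
  norm_num [Nat.factorial]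

lemma sum_det_expand (a b : Fin 6 → Fin 9 → k) :
    ∑ g : Fin 6 → Fin 9, (∏ n, a n (g n)) * Matrix.det (Matrix.of fun n m => b n (g m)) =
      Matrix.det (Matrix.of fun n m => b n ⬝ᵥ a m) := by
  simp only [Matrix.det_apply', Finset.mul_sum, Matrix.of_apply]
  rw [Finset.sum_comm]
  refine Finset.sum_congr rfl fun π _ => ?_
  simp only [dotProduct]
  rw [Finset.prod_univ_sum, Finset.mul_sum]
  simp only [Fintype.piFinset_univ, Finset.prod_mul_distrib]
  exact Finset.sum_congr rfl fun _ _ => by ring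

lemma det_of_row_zero {n : ℕ} (M : Matrix (Fin (n + 1)) (Fin (n + 1)) k) (h0 : M 0 0 = 1)
    (h1 : ∀ j : Fin n, M 0 j.succ = 0) : M.det = (M.submatrix Fin.succ Fin.succ).det := by
  rw [Matrix.det_succ_row_zero, Fin.sum_univ_succ]
  simp only [h1, h0]
  simp

lemma pair_cross_tens (a b : Fin 6 → Fin 9 → k) :
    pair (cross (tens (a 0) (a 1) (a 2)) (tens (a 3) (a 4) (a 5)))
      (cross (tens (b 0) (b 1) (b 2)) (tens (b 3) (b 4) (b 5))) =
      (1/216) * Matrix.det (Matrix.of fun n m => b n ⬝ᵥ a m) := by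
  rw [pair_comm, pair_cross, vol]
  have hb := cross_tens ![b 0, b 1, b 2] ![b 3, b 4, b 5]
  simp only [Matrix.cons_val] at hb
  have key : ∀ σ : Perm (Fin 9), ((Perm.sign σ : ℤ) : k) *
      (cross (tens (b 0) (b 1) (b 2)) (tens (b 3) (b 4) (b 5)) (σ 0) (σ 1) (σ 2) *
      tens (a 0) (a 1) (a 2) (σ 3) (σ 4) (σ 5) * tens (a 3) (a 4) (a 5) (σ 6) (σ 7) (σ 8)) =
      (1/36) * ((∏ n, a n (σ (Fin.natAdd 3 n))) * Matrix.det (Matrix.of fun n m =>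
        b n (σ (Fin.natAdd 3 m)))) := by
    intro σ
    have h := Matrix.det_permute' σ (Matrix.of ![Pi.single (σ 0) 1, Pi.single (σ 1) 1,
      Pi.single (σ 2) 1, b 0, b 1, b 2, b 3, b 4, b 5])
    have h' : (Matrix.submatrix (Matrix.of ![Pi.single (σ 0) 1, Pi.single (σ 1) 1,
      Pi.single (σ 2) 1, b 0, b 1, b 2, b 3, b 4, b 5]) id σ).det =
      Matrix.det (Matrix.of fun n m => b n (σ (Fin.natAdd 3 m))) := by
      rw [det_of_row_zero, det_of_row_zero, det_of_row_zero]
      · congr 1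
        ext p q
        have hq : (Fin.natAdd 3 q : Fin 9) = q.succ.succ.succ := by
          ext; simp only [Fin.val_natAdd, Fin.val_succ]; omega
        rw [Matrix.of_apply, hq]
        fin_cases p <;> rfl
      all_goals
        first
        | (intro q; fin_cases q <;> simp)
        | simp
    rw [h'] at h
    rw [hb, h]
    have hs : ((Perm.sign σ : ℤ) : k) * ((Perm.sign σ : ℤ) : k) = 1 := by
      rw [← Int.cast_mul, ← Units.val_mul, Int.units_mul_self]; simp
    have hp : ∏ n, a n (σ (Fin.natAdd 3 n)) =
        tens (a 0) (a 1) (a 2) (σ 3) (σ 4) (σ 5) * tens (a 3) (a 4) (a 5) (σ 6) (σ 7) (σ 8) := by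
      simp only [Fin.prod_univ_succ, tens, Fin.prod_univ_zero]
      simp [Fin.natAdd]
      ring
    rw [hp]
    ring
  rw [Finset.sum_congr rfl fun σ _ => key σ, ← Finset.mul_sum,
    sum_perm_tail (fun g => (∏ n, a n (g n)) * Matrix.det (Matrix.of fun n m => b n (g m))),
    sum_det_expand]
  · ring
  · intro g hg
    simp only [Function.Injective, not_forall] at hg
    obtain ⟨x, y, hxy, hne⟩ := hg
    rw [Matrix.det_zero_of_column_eq hne (by intro n; simp [hxy]), mul_zero]

lemma contract_tens (a b c a' b' c' : Fin 9 → k) :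
    contract (tens a b c) (tens a' b' c') =
      ((1/2) * ((b ⬝ᵥ b') * (c ⬝ᵥ c'))) • Matrix.vecMulVec a a' := by
  ext i j
  simp only [contract, tens, dotProduct, Matrix.smul_apply, smul_eq_mul,
    Matrix.vecMulVec_apply, Finset.sum_mul, Finset.mul_sum]
  rw [Finset.sum_comm]
  exact Finset.sum_congr rfl fun _ _ => Finset.sum_congr rfl fun _ _ => by ring

lemma contract_add_left (u v w : Tensor k) :
    contract (u + v) w = contract u w + contract v w := by
  ext i j
  simp only [contract, Pi.add_apply, add_mul, Finset.sum_add_distrib, mul_add, Matrix.add_apply]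

lemma contract_add_right (u v w : Tensor k) :
    contract u (v + w) = contract u v + contract u w := by
  ext i j
  simp only [contract, Pi.add_apply, Finset.sum_add_distrib, mul_add, Matrix.add_apply]

lemma contract_smul_left (c : k) (v w : Tensor k) :
    contract (c • v) w = c • contract v w := by
  ext i j
  simp only [contract, Pi.smul_apply, Finset.mul_sum, Matrix.smul_apply, smul_eq_mul]
  exact Finset.sum_congr rfl fun _ _ => Finset.sum_congr rfl fun _ _ => by ring

lemma contract_smul_right (c : k) (v w : Tensor k) :
    contract v (c • w) = c • contract v w := by
  ext i j
  simp only [contract, Pi.smul_apply, Finset.mul_sum, Matrix.smul_apply, smul_eq_mul]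
  exact Finset.sum_congr rfl fun _ _ => Finset.sum_congr rfl fun _ _ => by ring

lemma wedge_eq (a b c : Fin 9 → k) : wedge a b c = tens a b c + (-1 : k) • tens b a c +
    (-1 : k) • tens a c b + (-1 : k) • tens c b a + tens b c a + tens c a b := by
  simp only [wedge, neg_one_smul]; abel

lemma contract_wedge (a b c a' b' c' : Fin 9 → k) :
    contract (wedge a b c) (wedge a' b' c') =
      ((b ⬝ᵥ b') * (c ⬝ᵥ c') - (b ⬝ᵥ c') * (c ⬝ᵥ b')) • Matrix.vecMulVec a a' +
      ((b ⬝ᵥ c') * (c ⬝ᵥ a') - (b ⬝ᵥ a') * (c ⬝ᵥ c')) • Matrix.vecMulVec a b' +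
      ((b ⬝ᵥ a') * (c ⬝ᵥ b') - (b ⬝ᵥ b') * (c ⬝ᵥ a')) • Matrix.vecMulVec a c' +
      ((c ⬝ᵥ b') * (a ⬝ᵥ c') - (c ⬝ᵥ c') * (a ⬝ᵥ b')) • Matrix.vecMulVec b a' +
      ((c ⬝ᵥ c') * (a ⬝ᵥ a') - (c ⬝ᵥ a') * (a ⬝ᵥ c')) • Matrix.vecMulVec b b' +
      ((c ⬝ᵥ a') * (a ⬝ᵥ b') - (c ⬝ᵥ b') * (a ⬝ᵥ a')) • Matrix.vecMulVec b c' +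
      ((a ⬝ᵥ b') * (b ⬝ᵥ c') - (a ⬝ᵥ c') * (b ⬝ᵥ b')) • Matrix.vecMulVec c a' +
      ((a ⬝ᵥ c') * (b ⬝ᵥ a') - (a ⬝ᵥ a') * (b ⬝ᵥ c')) • Matrix.vecMulVec c b' +
      ((a ⬝ᵥ a') * (b ⬝ᵥ b') - (a ⬝ᵥ b') * (b ⬝ᵥ a')) • Matrix.vecMulVec c c' := by
  simp only [wedge_eq, contract_add_left, contract_add_right, contract_smul_left,
    contract_smul_right, contract_tens]
  module

lemma trace_vecMulVec_mul (a b c d : Fin 9 → k) :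
    (Matrix.vecMulVec a b * Matrix.vecMulVec c d).trace = (a ⬝ᵥ d) * (c ⬝ᵥ b) := by
  rw [Matrix.vecMulVec_mul_vecMulVec, Matrix.trace_vecMulVec, dotProduct_smul, smul_eq_mul,
    dotProduct_comm b c, mul_comm]

set_option maxHeartbeats 4000000 in
lemma quad_wedge (a b : Fin 6 → Fin 9 → k) :
    36 * 36 * ((1/216) * Matrix.det (Matrix.of fun n m => b n ⬝ᵥ a m)) =
    6 * (
    (contract (wedge (a 3) (a 4) (a 5)) (wedge (b 0) (b 1) (b 2)) *
      contract (wedge (a 0) (a 1) (a 2)) (wedge (b 3) (b 4) (b 5))).trace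
    - (contract (wedge (a 3) (a 4) (a 5)) (wedge (b 0) (b 1) (b 2))).trace *
      (contract (wedge (a 0) (a 1) (a 2)) (wedge (b 3) (b 4) (b 5))).trace / 9
    - (contract (wedge (a 0) (a 1) (a 2)) (wedge (b 0) (b 1) (b 2)) *
      contract (wedge (a 3) (a 4) (a 5)) (wedge (b 3) (b 4) (b 5))).trace
    + (contract (wedge (a 0) (a 1) (a 2)) (wedge (b 0) (b 1) (b 2))).trace *
      (contract (wedge (a 3) (a 4) (a 5)) (wedge (b 3) (b 4) (b 5))).trace / 9) := by
  have hdet : Matrix.det (Matrix.of fun n m => b n ⬝ᵥ a m) =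
      Matrix.det (Matrix.of fun n m => a n ⬝ᵥ b m) := by
    rw [← Matrix.det_transpose]
    congr 1
    ext n m
    simp [dotProduct_comm]
  rw [hdet]
  simp only [contract_wedge, Matrix.trace_add, Matrix.trace_smul, Matrix.trace_vecMulVec,
    add_mul, mul_add, Matrix.smul_mul, Matrix.mul_smul, trace_vecMulVec_mul, smul_eq_mul]
  generalize hx : (fun n m => a n ⬝ᵥ b m) = x
  have hx' : ∀ n m, a n ⬝ᵥ b m = x n m := fun n m => congrFun (congrFun hx n) m
  simp only [hx']
  simp only [Matrix.det_succ_row_zero (n := 5), Matrix.det_succ_row_zero (n := 4),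
    Matrix.det_succ_row_zero (n := 3), Matrix.det_fin_three, Fin.sum_univ_succ, Matrix.submatrix_apply,
    Matrix.of_apply]
  simp only [Fin.succAbove, Fin.reduceSucc, Fin.reduceCastSucc, Fin.reduceLT, if_true, if_false,
    Fin.coe_ofNat_eq_mod, Fin.val_succ,
    Fin.lt_irrefl, Fin.not_lt_zero]
  norm_num1
  ring

lemma cross_add_right (u v w : Tensor k) : cross w (u + v) = cross w u + cross w v := by
  rw [cross_comm, cross_add, cross_comm w u, cross_comm w v]; abel

lemma pair_add_left (u v w : Tensor k) : pair (u + v) w = pair u w + pair v w := by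
  rw [pair_comm, pair_add, pair_comm w u, pair_comm w v]

lemma isAlt_induction {p : Tensor k → Prop} (hw : ∀ a b c, p (wedge a b c))
    (hadd : ∀ u v, p u → p v → p (u + v)) {v : Tensor k} (hv : IsAlt v) : p v := by
  have h0 : p 0 := by
    have := hw 0 0 0
    have e : wedge (0 : Fin 9 → k) 0 0 = 0 := by funext i j l; simp [wedge, tens]
    rwa [e] at this
  have e : v = ∑ i, ∑ j, ∑ l,
      wedge (Pi.single i (v i j l / 6)) (Pi.single j 1) (Pi.single l 1) := by
    funext x y z
    simp only [Finset.sum_apply, wedge, tens, Pi.add_apply, Pi.sub_apply,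
      Finset.sum_add_distrib, Finset.sum_sub_distrib]
    simp only [Pi.single_apply, ite_mul, mul_ite, mul_one, mul_zero, zero_mul,
      Finset.sum_ite_eq, Finset.sum_ite_irrel, Finset.sum_const_zero, Finset.mem_univ, if_true]
    have h1 := (hv x y z).1
    have h2 := (hv x y z).2
    have h3 := (hv y x z).2
    have h4 := (hv x z y).1
    have h5 := (hv y z x).1
    rw [h5, h3, h4, h2, h1]
    ring
  rw [e]
  exact Finset.sum_induction _ p hadd h0 fun i _ => Finset.sum_induction _ p hadd h0 fun j _ =>
    Finset.sum_induction _ p hadd h0 fun l _ => hw _ _ _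

lemma quad (u v w x : Tensor k) (hu : IsAlt u) (hv : IsAlt v) (hw : IsAlt w) (hx : IsAlt x) :
    pair (cross u v) (cross w x) = 6 * (
      (contract v w * contract u x).trace
      - (contract v w).trace * (contract u x).trace / 9
      - (contract u w * contract v x).trace
      + (contract u w).trace * (contract v x).trace / 9) := by
  revert u v w x
  intro u v w x hu hv hw hx
  refine isAlt_induction (p := fun u => pair (cross u v) (cross w x) = 6 * (
      (contract v w * contract u x).trace - (contract v w).trace * (contract u x).trace / 9
      - (contract u w * contract v x).trace + (contract u w).trace * (contract v x).trace / 9))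
    (fun a0 a1 a2 => ?_) (fun u u' h h' => ?_) hu
  swap
  · simp only [cross_add, pair_add_left, contract_add_left, mul_add, add_mul, Matrix.trace_add]
      at h h' ⊢
    linear_combination h + h'
  refine isAlt_induction (p := fun v => pair (cross (wedge a0 a1 a2) v) (cross w x) = 6 * (
      (contract v w * contract (wedge a0 a1 a2) x).trace
      - (contract v w).trace * (contract (wedge a0 a1 a2) x).trace / 9
      - (contract (wedge a0 a1 a2) w * contract v x).trace
      + (contract (wedge a0 a1 a2) w).trace * (contract v x).trace / 9))
    (fun a3 a4 a5 => ?_) (fun u u' h h' => ?_) hv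
  swap
  · simp only [cross_add_right, pair_add_left, contract_add_left, mul_add, add_mul,
      Matrix.trace_add] at h h' ⊢
    linear_combination h + h'
  refine isAlt_induction (p := fun w => pair (cross (wedge a0 a1 a2) (wedge a3 a4 a5))
      (cross w x) = 6 * (
      (contract (wedge a3 a4 a5) w * contract (wedge a0 a1 a2) x).trace
      - (contract (wedge a3 a4 a5) w).trace * (contract (wedge a0 a1 a2) x).trace / 9
      - (contract (wedge a0 a1 a2) w * contract (wedge a3 a4 a5) x).trace
      + (contract (wedge a0 a1 a2) w).trace * (contract (wedge a3 a4 a5) x).trace / 9))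
    (fun b0 b1 b2 => ?_) (fun u u' h h' => ?_) hw
  swap
  · simp only [cross_add, pair_add, contract_add_right, mul_add, add_mul,
      Matrix.trace_add] at h h' ⊢
    linear_combination h + h'
  refine isAlt_induction (p := fun x => pair (cross (wedge a0 a1 a2) (wedge a3 a4 a5))
      (cross (wedge b0 b1 b2) x) = 6 * (
      (contract (wedge a3 a4 a5) (wedge b0 b1 b2) * contract (wedge a0 a1 a2) x).trace
      - (contract (wedge a3 a4 a5) (wedge b0 b1 b2)).trace *
        (contract (wedge a0 a1 a2) x).trace / 9
      - (contract (wedge a0 a1 a2) (wedge b0 b1 b2) * contract (wedge a3 a4 a5) x).trace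
      + (contract (wedge a0 a1 a2) (wedge b0 b1 b2)).trace *
        (contract (wedge a3 a4 a5) x).trace / 9))
    (fun b3 b4 b5 => ?_) (fun u u' h h' => ?_) hx
  swap
  · simp only [cross_add_right, pair_add, contract_add_right, mul_add,
      Matrix.trace_add] at h h' ⊢
    linear_combination h + h'
  have h1 := quad_wedge ![a0, a1, a2, a3, a4, a5] ![b0, b1, b2, b3, b4, b5]
  have h2 := pair_cross_tens ![a0, a1, a2, a3, a4, a5] ![b0, b1, b2, b3, b4, b5]
  simp only [Matrix.cons_val] at h1 h2
  rw [← h1, ← h2, cross_wedge_wedge, cross_wedge_wedge, pair_smul, pair_comm, pair_smul,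
    pair_comm]
  ring

lemma isAlt_lieAct (X : Matrix (Fin 9) (Fin 9) k) {v : Tensor k} (hv : IsAlt v) :
    IsAlt (lieAct X v) := by
  intro i j l
  simp only [lieAct, ← Finset.sum_neg_distrib]
  constructor
  · refine Finset.sum_congr rfl fun p _ => ?_
    rw [(hv p i l).1, (hv p j l).1, (hv i j p).1]; ring
  · refine Finset.sum_congr rfl fun p _ => ?_
    rw [(hv p j l).2, (hv i p l).2, (hv i j p).2]; ring

lemma isAlt_sub {u v : Tensor k} (hu : IsAlt u) (hv : IsAlt v) : IsAlt (u - v) := by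
  intro i j l
  simp only [Pi.sub_apply, (hu i j l).1, (hu i j l).2, (hv i j l).1, (hv i j l).2]
  constructor <;> ring

lemma eq_zero_of_pair_alt {D : Tensor k} (hD : IsAlt D) (h : ∀ w, IsAlt w → pair w D = 0) :
    D = 0 := by
  refine pair_eq_zero fun u => ?_
  have s1 : ∀ u : Tensor k, pair (fun i j l => u j i l) D = -pair u D := by
    intro u
    simp only [pair, ← Finset.sum_neg_distrib]
    rw [Finset.sum_comm]
    refine Finset.sum_congr rfl fun i _ => Finset.sum_congr rfl fun j _ =>
      Finset.sum_congr rfl fun l _ => ?_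
    rw [(hD i j l).1]; ring
  have s2 : ∀ u : Tensor k, pair (fun i j l => u i l j) D = -pair u D := by
    intro u
    simp only [pair, ← Finset.sum_neg_distrib]
    refine Finset.sum_congr rfl fun i _ => ?_
    rw [Finset.sum_comm]
    refine Finset.sum_congr rfl fun j _ => Finset.sum_congr rfl fun l _ => ?_
    rw [(hD i j l).2]; ring
  have h6 : 6 * pair u D = pair (fun i j l =>
      u i j l - u j i l - u i l j - u l j i + u j l i + u l i j) D := by
    have e1 := s1 u
    have e2 := s2 u
    have e3 := s1 (fun i j l => u i l j)
    have e4 := s2 (fun i j l => u j i l)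
    have e5 := s1 (fun i j l => u l i j)
    have : pair (fun i j l =>
      u i j l - u j i l - u i l j - u l j i + u j l i + u l i j) D = pair u D -
      pair (fun i j l => u j i l) D - pair (fun i j l => u i l j) D -
      pair (fun i j l => u l j i) D + pair (fun i j l => u j l i) D +
      pair (fun i j l => u l i j) D := by
      simp only [pair, ← Finset.sum_add_distrib, ← Finset.sum_sub_distrib]
      refine Finset.sum_congr rfl fun i _ => Finset.sum_congr rfl fun j _ =>
        Finset.sum_congr rfl fun l _ => ?_
      ring
    rw [this, e5, e4, e3, e2, e1]
    ring
  have h7 := h (fun i j l => u i j l - u j i l - u i l j - u l j i + u j l i + u l i j)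
    (fun i j l => ⟨by ring, by ring⟩)
  rw [h7] at h6
  exact (mul_eq_zero.mp h6).resolve_left (by norm_num)

lemma cross_cross (u v w : Tensor k) (hu : IsAlt u) (hv : IsAlt v) (hw : IsAlt w) :
    cross (cross u v) w = lieAct (traceless (contract v w)) u -
      lieAct (traceless (contract u w)) v := by
  rw [← sub_eq_zero]
  refine eq_zero_of_pair_alt (isAlt_sub (isAlt_cross _ _)
    (isAlt_sub (isAlt_lieAct _ hu) (isAlt_lieAct _ hv))) fun x hx => ?_
  rw [pair_sub, pair_sub, pair_cross, vol_rotate, ← pair_cross, quad u v w x hu hv hw hx,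
    pair_lieAct_contract _ _ _ hu hx, pair_lieAct_contract _ _ _ hv hx]
  simp only [traceless, sub_mul, Matrix.trace_sub, Matrix.smul_mul, one_mul, Matrix.trace_smul,
    smul_eq_mul]
  ring

lemma lieAct_add (X : Matrix (Fin 9) (Fin 9) k) (v w : Tensor k) :
    lieAct X (v + w) = lieAct X v + lieAct X w := by
  funext i j l
  simp only [lieAct, Pi.add_apply, ← Finset.sum_add_distrib]
  exact Finset.sum_congr rfl fun _ _ => by ring

lemma lieAct_smul (X : Matrix (Fin 9) (Fin 9) k) (c : k) (v : Tensor k) :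
    lieAct X (c • v) = c • lieAct X v := by
  funext i j l
  simp only [lieAct, Pi.smul_apply, smul_eq_mul, Finset.mul_sum]
  exact Finset.sum_congr rfl fun _ _ => by ring

lemma add_lieAct (X Y : Matrix (Fin 9) (Fin 9) k) (v : Tensor k) :
    lieAct (X + Y) v = lieAct X v + lieAct Y v := by
  funext i j l
  simp only [lieAct, Pi.add_apply, Matrix.add_apply, ← Finset.sum_add_distrib]
  exact Finset.sum_congr rfl fun _ _ => by ring

lemma smul_lieAct (c : k) (X : Matrix (Fin 9) (Fin 9) k) (v : Tensor k) :
    lieAct (c • X) v = c • lieAct X v := by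
  funext i j l
  simp only [lieAct, Pi.smul_apply, Matrix.smul_apply, smul_eq_mul, Finset.mul_sum]
  exact Finset.sum_congr rfl fun _ _ => by ring

lemma cross_smul_right (c : k) (v w : Tensor k) : cross v (c • w) = c • cross v w := by
  rw [cross_comm, cross_smul, cross_comm, smul_neg, neg_neg, ]

lemma traceless_add (M N : Matrix (Fin 9) (Fin 9) k) :
    traceless (M + N) = traceless M + traceless N := by
  simp only [traceless, Matrix.trace_add, add_div]; module

lemma traceless_smul (c : k) (M : Matrix (Fin 9) (Fin 9) k) :
    traceless (c • M) = c • traceless M := by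
  simp only [traceless, Matrix.trace_smul, smul_eq_mul, mul_div_assoc]; module

lemma trace_traceless (M : Matrix (Fin 9) (Fin 9) k) : (traceless M).trace = 0 := by
  simp only [traceless, Matrix.trace_sub, Matrix.trace_smul, Matrix.trace_one, smul_eq_mul,
    Fintype.card_fin]
  push_cast
  ring

lemma contract_transpose (v w : Tensor k) : (contract v w).transpose = contract w v := by
  ext i j
  simp only [contract, Matrix.transpose_apply]
  congr 1
  exact Finset.sum_congr rfl fun _ _ => Finset.sum_congr rfl fun _ _ => by ring

lemma moment_add_left (u v w : Tensor k) : moment (u + v) w = moment u w + moment v w := by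
  rw [moment, contract_add_left, traceless_add]; rfl
lemma moment_add_right (u v w : Tensor k) : moment u (v + w) = moment u v + moment u w := by
  rw [moment, contract_add_right, traceless_add]; rfl
lemma moment_smul_left (c : k) (v w : Tensor k) : moment (c • v) w = c • moment v w := by
  rw [moment, contract_smul_left, traceless_smul]; rfl
lemma moment_smul_right (c : k) (v w : Tensor k) : moment v (c • w) = c • moment v w := by
  rw [moment, contract_smul_right, traceless_smul]; rfl

lemma moment_transpose (v w : Tensor k) : (moment v w).transpose = moment w v := by
  rw [moment, moment, traceless, traceless, Matrix.transpose_sub, Matrix.transpose_smul,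
    Matrix.transpose_one, contract_transpose, ← contract_transpose v w, Matrix.trace_transpose]

lemma moment_lieAct (X : Matrix (Fin 9) (Fin 9) k) (v w : Tensor k) :
    moment (lieAct X v) w + moment v (lieAct (-X.transpose) w) =
      X * moment v w - moment v w * X := by
  rw [moment, moment, ← traceless_add, contract_lieAct]
  simp only [moment, traceless, Matrix.trace_sub, mul_sub, sub_mul, Matrix.mul_smul,
    Matrix.smul_mul, mul_one, one_mul, Matrix.trace_mul_comm X]
  simp

lemma moment_cyclic (u v w : Tensor k) (hu : IsAlt u) (hv : IsAlt v) (hw : IsAlt w) :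
    moment u (cross v w) + moment v (cross w u) + moment w (cross u v) = 0 := by
  simp only [moment, ← traceless_add]
  rw [contract_cyclic u v w hu hv hw, traceless_smul, traceless]
  simp

variable (A B C : Matrix (Fin 9) (Fin 9) k) (a b c α β γ : Tensor k)

lemma sub_lieAct (X Y : Matrix (Fin 9) (Fin 9) k) (v : Tensor k) :
    lieAct (X - Y) v = lieAct X v - lieAct Y v := by
  rw [sub_eq_add_neg, add_lieAct, ← neg_one_smul k Y, smul_lieAct, neg_one_smul]; abel
lemma neg_lieAct (Y : Matrix (Fin 9) (Fin 9) k) (v : Tensor k) :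
    lieAct (-Y) v = - lieAct Y v := by
  rw [← neg_one_smul k Y, smul_lieAct, neg_one_smul]
lemma lieAct_sub (X : Matrix (Fin 9) (Fin 9) k) (v w : Tensor k) :
    lieAct X (v - w) = lieAct X v - lieAct X w := by
  rw [sub_eq_add_neg, lieAct_add, ← neg_one_smul k w, lieAct_smul, neg_one_smul]; abel
lemma cross_sub (u v w : Tensor k) : cross (u - v) w = cross u w - cross v w := by
  rw [sub_eq_add_neg, cross_add, ← neg_one_smul k v, cross_smul, neg_one_smul]; abel
lemma cross_sub_right (u v w : Tensor k) : cross w (u - v) = cross w u - cross w v := by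
  rw [sub_eq_add_neg, cross_add_right, ← neg_one_smul k v, cross_smul_right, neg_one_smul]; abel
lemma moment_sub_left (u v w : Tensor k) : moment (u - v) w = moment u w - moment v w := by
  rw [sub_eq_add_neg, moment_add_left, ← neg_one_smul k v, moment_smul_left, neg_one_smul]; abel
lemma moment_sub_right (u v w : Tensor k) : moment w (u - v) = moment w u - moment w v := by
  rw [sub_eq_add_neg, moment_add_right, ← neg_one_smul k v, moment_smul_right, neg_one_smul]; abel

lemma jacobi0 (ha : IsAlt a) (hb : IsAlt b) (hc : IsAlt c) (hα : IsAlt α) (hβ : IsAlt β)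
    (hγ : IsAlt γ) :
    br0 A (br0 B C b c β γ) a (br1 B C b c β γ) α (brN B C b c β γ) =
      br0 (br0 A B a b α β) C (br1 A B a b α β) c (brN A B a b α β) γ +
      br0 B (br0 A C a c α γ) b (br1 A C a c α γ) β (brN A C a c α γ) := by
  have h1 := moment_cyclic a b c ha hb hc
  have h2 := congrArg Matrix.transpose (moment_cyclic α β γ hα hβ hγ)
  simp only [Matrix.transpose_add, moment_transpose, Matrix.transpose_zero] at h2
  have h3 := moment_lieAct A b γ
  have h4 := moment_lieAct A c β
  have h5 := moment_lieAct B a γ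
  have h6 := moment_lieAct B c α
  have h7 := moment_lieAct C a β
  have h8 := moment_lieAct C b α
  have n1 : ∀ u, moment u (cross c a) = - moment u (cross a c) := fun u => by
    rw [cross_comm, ← neg_one_smul k, moment_smul_right, neg_one_smul]
  have n2 : ∀ u, moment (cross γ α) u = - moment (cross α γ) u := fun u => by
    rw [cross_comm, ← neg_one_smul k, moment_smul_left, neg_one_smul]
  rw [n1] at h1
  rw [n2] at h2
  simp only [br0, br1, brN, mul_add, mul_sub, add_mul, sub_mul, moment_sub_left, moment_sub_right, moment_add_right, ← mul_assoc]
  linear_combination (norm := module) h1 + h2 - h3 + h4 + h5 - h6 - h7 + h8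

lemma jacobi1 (hA : A.trace = 0) (hB : B.trace = 0) (hC : C.trace = 0)
    (ha : IsAlt a) (hb : IsAlt b) (hc : IsAlt c) (hα : IsAlt α) (hβ : IsAlt β)
    (hγ : IsAlt γ) :
    br1 A (br0 B C b c β γ) a (br1 B C b c β γ) α (brN B C b c β γ) =
      br1 (br0 A B a b α β) C (br1 A B a b α β) c (brN A B a b α β) γ +
      br1 B (br0 A C a c α γ) b (br1 A C a c α γ) β (brN A C a c α γ) := by
  have hneg : ∀ {X : Matrix (Fin 9) (Fin 9) k}, X.trace = 0 → (-X.transpose).trace = 0 := by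
    intro X hX; rw [Matrix.trace_neg, Matrix.trace_transpose, hX, neg_zero]
  have h1 := lieAct_lieAct A B c
  have h2 := lieAct_lieAct A C b
  have h3 := lieAct_lieAct B C a
  have h4 := cross_lieAct _ (hneg hA) β γ
  have h5 := cross_lieAct _ (hneg hB) α γ
  have h6 := cross_lieAct _ (hneg hC) α β
  have h7 := cross_cross b c α hb hc hα
  have h8 := cross_cross a c β ha hc hβ
  have h9 := cross_cross a b γ ha hb hγ
  rw [cross_comm] at h7 h8
  change _ = lieAct (moment _ _) _ - lieAct (moment _ _) _ at h7 h8 h9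
  simp only [Matrix.transpose_neg, Matrix.transpose_transpose, neg_neg] at h4 h5 h6
  simp only [br0, br1, brN, add_lieAct, sub_lieAct, lieAct_sub, cross_add, cross_sub,
    cross_add_right, cross_sub_right] at h1 h2 h3 ⊢
  have n1 := cross_comm (lieAct (-C.transpose) α) β
  linear_combination (norm := module) - h1 + h2 - h3 + h4 - h5 + h6 + h7 - h8 + h9 - n1

lemma jacobiN (hA : A.trace = 0) (hB : B.trace = 0) (hC : C.trace = 0)
    (ha : IsAlt a) (hb : IsAlt b) (hc : IsAlt c) (hα : IsAlt α) (hβ : IsAlt β)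
    (hγ : IsAlt γ) :
    brN A (br0 B C b c β γ) a (br1 B C b c β γ) α (brN B C b c β γ) =
      brN (br0 A B a b α β) C (br1 A B a b α β) c (brN A B a b α β) γ +
      brN B (br0 A C a c α γ) b (br1 A C a c α γ) β (brN A C a c α γ) := by
  have h1 := lieAct_lieAct (-A.transpose) (-B.transpose) γ
  have h2 := lieAct_lieAct (-A.transpose) (-C.transpose) β
  have h3 := lieAct_lieAct (-B.transpose) (-C.transpose) α
  have h4 := cross_lieAct _ hA b c
  have h5 := cross_lieAct _ hB a c
  have h6 := cross_lieAct _ hC a b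
  have h7 := cross_cross β γ a hβ hγ ha
  have h8 := cross_cross α γ b hα hγ hb
  have h9 := cross_cross α β c hα hβ hc
  rw [cross_comm] at h7 h8
  change _ = lieAct (moment _ _) _ - lieAct (moment _ _) _ at h7 h8 h9
  simp only [br0, br1, brN, add_lieAct, sub_lieAct, neg_lieAct, lieAct_sub, lieAct_add, cross_sub,
    cross_sub_right, Matrix.transpose_add, Matrix.transpose_sub,
    Matrix.transpose_mul, neg_mul_neg, neg_sub, moment_transpose] at *
  have n1 := cross_comm (lieAct C a) b
  linear_combination (norm := module) - h1 + h2 - h3 - h4 + h5 - h6 + h7 - h8 + h9 + n1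

end Tensors

section LieAlgebra

variable (k : Type*) [Field k]

/-- The space `⋀³ k⁹` of trivectors, as the space of alternating tensors. -/
def Tri : Submodule k (Tensor k) where
  carrier := {v | IsAlt v}
  add_mem' := isAlt_add
  zero_mem' := isAlt_zero
  smul_mem' := isAlt_smul

/-- The vector space `𝔤 = 𝔤₀ ⊕ 𝔤₁ ⊕ 𝔤₋₁ = 𝔰𝔩(9, k) ⊕ ⋀³ k⁹ ⊕ ⋀³ (k⁹)*`, of dimension
`80 + 84 + 84 = 248`. -/
@[ext]
structure E8 where
  /-- component in `𝔤₀ = 𝔰𝔩(9, k)` -/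
  zero : LieAlgebra.SpecialLinear.sl (Fin 9) k
  /-- component in `𝔤₁ = ⋀³ k⁹` -/
  one : Tri k
  /-- component in `𝔤₋₁ = ⋀³ (k⁹)*` -/
  negOne : Tri k

variable {k}

namespace E8

/-- `E8 k` as a product. -/
def equivProd : E8 k ≃ LieAlgebra.SpecialLinear.sl (Fin 9) k × Tri k × Tri k where
  toFun x := (x.zero, x.one, x.negOne)
  invFun x := ⟨x.1, x.2.1, x.2.2⟩

instance : AddCommGroup (E8 k) := equivProd.addCommGroup
instance : Module k (E8 k) := equivProd.module k

@[simp] lemma add_zero' (x y : E8 k) : (x + y).zero = x.zero + y.zero := rfl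
@[simp] lemma add_one' (x y : E8 k) : (x + y).one = x.one + y.one := rfl
@[simp] lemma add_negOne (x y : E8 k) : (x + y).negOne = x.negOne + y.negOne := rfl
@[simp] lemma smul_zero' (c : k) (x : E8 k) : (c • x).zero = c • x.zero := rfl
@[simp] lemma smul_one' (c : k) (x : E8 k) : (c • x).one = c • x.one := rfl
@[simp] lemma smul_negOne (c : k) (x : E8 k) : (c • x).negOne = c • x.negOne := rfl
@[simp] lemma zero_zero' : (0 : E8 k).zero = 0 := rfl
@[simp] lemma zero_one' : (0 : E8 k).one = 0 := rfl
@[simp] lemma zero_negOne : (0 : E8 k).negOne = 0 := rfl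

lemma trace_eq_zero (x : E8 k) : Matrix.trace (x.zero : Matrix (Fin 9) (Fin 9) k) = 0 :=
  LinearMap.mem_ker.mp x.zero.2

/-- Equality of elements can be tested on the underlying matrices and tensors. -/
lemma ext_val {x y : E8 k} (h0 : (x.zero : Matrix (Fin 9) (Fin 9) k) = y.zero)
    (h1 : (x.one : Tensor k) = y.one) (h2 : (x.negOne : Tensor k) = y.negOne) : x = y :=
  E8.ext (Subtype.ext h0) (Subtype.ext h1) (Subtype.ext h2)

/-- The action of `SL(9, k)` on `𝔤`: conjugation on `𝔰𝔩(9, k)`, the natural action on `⋀³ k⁹`,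
and the dual action on `⋀³ (k⁹)*`. -/
instance : SMul SL(9, k) (E8 k) where
  smul g x :=
    { zero := ⟨g.1 * x.zero.1 * (g⁻¹).1, LinearMap.mem_ker.mpr (by
        rw [Matrix.traceLinearMap_apply, Matrix.trace_mul_comm, ← mul_assoc,
          ← Matrix.SpecialLinearGroup.coe_mul, inv_mul_cancel, Matrix.SpecialLinearGroup.coe_one,
          one_mul]
        exact x.trace_eq_zero)⟩
      one := ⟨matAct g.1 x.one, isAlt_matAct _ x.one.2⟩
      negOne := ⟨matAct (g⁻¹).1.transpose x.negOne, isAlt_matAct _ x.negOne.2⟩ }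

lemma smul_zero_val (g : SL(9, k)) (x : E8 k) :
    (g • x).zero.1 = g.1 * x.zero.1 * (g⁻¹).1 := rfl
lemma smul_one_val (g : SL(9, k)) (x : E8 k) :
    (g • x).one.1 = matAct g.1 x.one.1 := rfl
lemma smul_negOne_val (g : SL(9, k)) (x : E8 k) :
    (g • x).negOne.1 = matAct (g⁻¹).1.transpose x.negOne.1 := rfl

instance : MulAction SL(9, k) (E8 k) where
  one_smul x := by
    refine ext_val ?_ ?_ ?_
    · rw [smul_zero_val, inv_one, Matrix.SpecialLinearGroup.coe_one, one_mul, mul_one]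
    · rw [smul_one_val, Matrix.SpecialLinearGroup.coe_one, matAct_one]
    · rw [smul_negOne_val, inv_one, Matrix.SpecialLinearGroup.coe_one, Matrix.transpose_one,
        matAct_one]
  mul_smul g h x := by
    refine ext_val ?_ ?_ ?_
    · simp only [smul_zero_val, mul_inv_rev, Matrix.SpecialLinearGroup.coe_mul, mul_assoc]
    · simp only [smul_one_val, Matrix.SpecialLinearGroup.coe_mul, matAct_mul]
    · simp only [smul_negOne_val, mul_inv_rev, Matrix.SpecialLinearGroup.coe_mul,
        Matrix.transpose_mul, matAct_mul]

/-- The map `E8 k → E8 K` that applies a homomorphism of fields to all coordinates. -/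
def map {K : Type*} [Field K] (φ : k →+* K) (x : E8 k) : E8 K where
  zero := ⟨x.zero.1.map φ, LinearMap.mem_ker.mpr (by
    rw [Matrix.traceLinearMap_apply]
    have h := congrArg φ x.trace_eq_zero
    rw [map_zero, Matrix.trace, map_sum] at h
    exact h)⟩
  one := ⟨fun i j l => φ (x.one.1 i j l), fun i j l =>
    ⟨(congrArg φ (x.one.2 i j l).1).trans (map_neg φ _),
      (congrArg φ (x.one.2 i j l).2).trans (map_neg φ _)⟩⟩
  negOne := ⟨fun i j l => φ (x.negOne.1 i j l), fun i j l =>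
    ⟨(congrArg φ (x.negOne.2 i j l).1).trans (map_neg φ _),
      (congrArg φ (x.negOne.2 i j l).2).trans (map_neg φ _)⟩⟩

lemma matAct_map {K : Type*} [Field K] (φ : k →+* K) (g : Matrix (Fin 9) (Fin 9) k)
    (v : Tensor k) :
    (fun i j l => φ (matAct g v i j l)) = matAct (g.map φ) fun i j l => φ (v i j l) := by
  funext i j l
  simp [matAct]

lemma map_smul_group {K : Type*} [Field K] (φ : k →+* K) (g : SL(9, k)) (x : E8 k) :
    map φ (g • x) = Matrix.SpecialLinearGroup.map φ g • map φ x := by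
  have hg : ((Matrix.SpecialLinearGroup.map φ g)⁻¹ : SL(9, K)) =
      Matrix.SpecialLinearGroup.map φ g⁻¹ := (map_inv _ _).symm
  refine ext_val ?_ ?_ ?_
  · rw [smul_zero_val, hg]
    change (g.1 * x.zero.1 * (g⁻¹).1).map φ = g.1.map φ * x.zero.1.map φ * (g⁻¹).1.map φ
    rw [Matrix.map_mul, Matrix.map_mul]
  · exact matAct_map φ g.1 x.one.1
  · rw [smul_negOne_val, hg]
    exact matAct_map φ (g⁻¹).1.transpose x.negOne.1

variable [CharZero k]

instance : Bracket (E8 k) (E8 k) where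
  bracket x y :=
    { zero := ⟨br0 x.zero y.zero x.one y.one x.negOne y.negOne, LinearMap.mem_ker.mpr (by
        simp [br0, moment, trace_traceless, Matrix.trace_mul_comm (y.zero : Matrix (Fin 9) (Fin 9) k)])⟩
      one := ⟨br1 x.zero y.zero x.one y.one x.negOne y.negOne,
        isAlt_sub (isAlt_sub (isAlt_lieAct _ y.one.2) (isAlt_lieAct _ x.one.2))
          (isAlt_cross _ _)⟩
      negOne := ⟨brN x.zero y.zero x.one y.one x.negOne y.negOne,
        isAlt_add (isAlt_sub (isAlt_lieAct _ y.negOne.2) (isAlt_lieAct _ x.negOne.2))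
          (isAlt_cross _ _)⟩ }

lemma lie_zero_val (x y : E8 k) : ((⁅x, y⁆ : E8 k).zero : Matrix (Fin 9) (Fin 9) k) =
    br0 x.zero y.zero x.one y.one x.negOne y.negOne := rfl
lemma lie_one_val (x y : E8 k) : ((⁅x, y⁆ : E8 k).one : Tensor k) =
    br1 x.zero y.zero x.one y.one x.negOne y.negOne := rfl
lemma lie_negOne_val (x y : E8 k) : ((⁅x, y⁆ : E8 k).negOne : Tensor k) =
    brN x.zero y.zero x.one y.one x.negOne y.negOne := rfl

lemma lie_antisymm (x y : E8 k) : ⁅x, y⁆ + ⁅y, x⁆ = 0 := by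
  refine ext_val ?_ ?_ ?_
  · change br0 _ _ _ _ _ _ + br0 _ _ _ _ _ _ = 0
    simp only [br0]; abel
  · change br1 _ _ _ _ _ _ + br1 _ _ _ _ _ _ = 0
    simp only [br1, cross_comm (x.negOne : Tensor k) y.negOne]; abel
  · change brN _ _ _ _ _ _ + brN _ _ _ _ _ _ = 0
    simp only [brN, cross_comm (x.one : Tensor k) y.one]; abel

lemma add_lie_aux (x y z : E8 k) : ⁅x + y, z⁆ = ⁅x, z⁆ + ⁅y, z⁆ := by
  refine ext_val ?_ ?_ ?_
  · change br0 (x.zero + y.zero : Matrix (Fin 9) (Fin 9) k) _ (x.one + y.one : Tensor k) _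
      (x.negOne + y.negOne : Tensor k) _ = br0 _ _ _ _ _ _ + br0 _ _ _ _ _ _
    simp only [br0, add_mul, mul_add, moment_add_left, moment_add_right]; abel
  · change br1 (x.zero + y.zero : Matrix (Fin 9) (Fin 9) k) _ (x.one + y.one : Tensor k) _
      (x.negOne + y.negOne : Tensor k) _ = br1 _ _ _ _ _ _ + br1 _ _ _ _ _ _
    simp only [br1, add_lieAct, lieAct_add, cross_add]; abel
  · change brN (x.zero + y.zero : Matrix (Fin 9) (Fin 9) k) _ (x.one + y.one : Tensor k) _
      (x.negOne + y.negOne : Tensor k) _ = brN _ _ _ _ _ _ + brN _ _ _ _ _ _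
    simp only [brN, Matrix.transpose_add, neg_add, add_lieAct, lieAct_add, cross_add]; abel

lemma lie_swap (x y : E8 k) : ⁅x, y⁆ = -⁅y, x⁆ := eq_neg_of_add_eq_zero_left (lie_antisymm x y)

instance : LieRing (E8 k) where
  add_lie := add_lie_aux
  lie_add x y z := by
    rw [lie_swap, add_lie_aux, neg_add, ← lie_swap, ← lie_swap]
  lie_self x := by
    have h := lie_antisymm x x
    rw [← two_smul k] at h
    exact (smul_eq_zero.mp h).resolve_left two_ne_zero
  leibniz_lie x y z := by
    refine ext_val ?_ ?_ ?_
    · exact jacobi0 _ _ _ _ _ _ _ _ _ x.one.2 y.one.2 z.one.2 x.negOne.2 y.negOne.2 z.negOne.2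
    · exact jacobi1 _ _ _ _ _ _ _ _ _ x.trace_eq_zero y.trace_eq_zero z.trace_eq_zero
        x.one.2 y.one.2 z.one.2 x.negOne.2 y.negOne.2 z.negOne.2
    · exact jacobiN _ _ _ _ _ _ _ _ _ x.trace_eq_zero y.trace_eq_zero z.trace_eq_zero
        x.one.2 y.one.2 z.one.2 x.negOne.2 y.negOne.2 z.negOne.2

instance : LieAlgebra k (E8 k) where
  lie_smul c x y := by
    refine ext_val ?_ ?_ ?_
    · change br0 _ (c • y.zero : Matrix (Fin 9) (Fin 9) k) _ (c • y.one : Tensor k) _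
        (c • y.negOne : Tensor k) = c • br0 _ _ _ _ _ _
      simp only [br0, mul_smul_comm, smul_mul_assoc, moment_smul_left, moment_smul_right]; module
    · change br1 _ (c • y.zero : Matrix (Fin 9) (Fin 9) k) _ (c • y.one : Tensor k) _
        (c • y.negOne : Tensor k) = c • br1 _ _ _ _ _ _
      simp only [br1, smul_lieAct, lieAct_smul, cross_smul_right]; module
    · change brN _ (c • y.zero : Matrix (Fin 9) (Fin 9) k) _ (c • y.one : Tensor k) _
        (c • y.negOne : Tensor k) = c • brN _ _ _ _ _ _
      simp only [brN, Matrix.transpose_smul, neg_lieAct, smul_lieAct, lieAct_smul,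
        cross_smul_right]; module

/-- The homogeneous components of the `ℤ/3`-grading. -/
def gr (d : ZMod 3) : Submodule k (E8 k) where
  carrier := {x | (d ≠ 0 → x.zero = 0) ∧ (d ≠ 1 → x.one = 0) ∧ (d ≠ -1 → x.negOne = 0)}
  add_mem' {x y} hx hy := ⟨fun h => by simp [hx.1 h, hy.1 h],
    fun h => by simp [hx.2.1 h, hy.2.1 h], fun h => by simp [hx.2.2 h, hy.2.2 h]⟩
  zero_mem' := by simp
  smul_mem' c x hx := ⟨fun h => by simp [hx.1 h],
    fun h => by simp [hx.2.1 h], fun h => by simp [hx.2.2 h]⟩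

/-- `(h, e, f)` is an `𝔰𝔩₂`-triple, homogeneous with respect to the `ℤ/3`-grading. The zero triple
is allowed. -/
structure IsHomogeneousSl2Triple (h e f : E8 k) : Prop where
  h_mem : h ∈ gr (k := k) 0
  e_mem : e ∈ gr (k := k) 1
  f_mem : f ∈ gr (k := k) (-1)
  lie_e_f : ⁅e, f⁆ = h
  lie_h_e : ⁅h, e⁆ = (2 : k) • e
  lie_h_f : ⁅h, f⁆ = (-2 : k) • f

/-- The embedding of the real Lie algebra into its complexification. -/
noncomputable def ofReal (x : E8 ℝ) : E8 ℂ := map Complex.ofRealHom x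

/-- Complex conjugation on the complex Lie algebra. -/
noncomputable def conj (x : E8 ℂ) : E8 ℂ := map (starRingEnd ℂ) x

lemma conj_ofReal (x : E8 ℝ) : conj (ofReal x) = ofReal x := by
  refine ext_val ?_ ?_ ?_
  · ext i j
    exact Complex.conj_ofReal _
  · funext i j l
    exact Complex.conj_ofReal _
  · funext i j l
    exact Complex.conj_ofReal _

end E8
end LieAlgebra

section Cohomology

/-- A `Γ`-group for `Γ = Gal(ℂ/ℝ)`: a group together with an involutive automorphism `σ`. -/
structure GammaStructure (A : Type*) [Group A] where
  σ : A →* A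
  invol : ∀ a, σ (σ a) = a

variable {A : Type*} [Group A]

/-- The set of `1`-cocycles of a `Γ`-group. -/
def GammaStructure.Z1 (s : GammaStructure A) : Type _ := {c : A // c * s.σ c = 1}

/-- Two cocycles `c`, `c'` are cohomologous when `c' = a⁻¹ * c * σ a` for some `a`. -/
def GammaStructure.cohomologous (s : GammaStructure A) : Setoid s.Z1 where
  r c c' := ∃ a : A, c'.1 = a⁻¹ * c.1 * s.σ a
  iseqv :=
    { refl := fun c => ⟨1, by simp⟩
      symm := by
        rintro c c' ⟨a, h⟩
        exact ⟨a⁻¹, by rw [h, map_inv]; group⟩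
      trans := by
        rintro c c' c'' ⟨a, h⟩ ⟨b, h'⟩
        exact ⟨a * b, by rw [h', h, map_mul]; group⟩ }

/-- The first Galois cohomology set `H¹ A` of a `Γ`-group `A`. -/
def GammaStructure.H1 (s : GammaStructure A) : Type _ := Quotient s.cohomologous

/-- The class in `H¹ A` of a cocycle. -/
def GammaStructure.toH1 (s : GammaStructure A) (c : s.Z1) : s.H1 := Quotient.mk s.cohomologous c

end Cohomology

/-- Complex conjugation on `SL(9, ℂ)`. -/
noncomputable def conjSL : SL(9, ℂ) →* SL(9, ℂ) := Matrix.SpecialLinearGroup.map (starRingEnd ℂ)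

lemma conjSL_conjSL (g : SL(9, ℂ)) : conjSL (conjSL g) = g := by
  ext i j
  exact Complex.conj_conj _

/-- The stabilizer `Z_{SL(9, ℂ)}(t)` of a real triple `t = (h, e, f)`. -/
noncomputable def centralizer (h e f : E8 ℝ) : Subgroup SL(9, ℂ) :=
  MulAction.stabilizer SL(9, ℂ) (E8.ofReal h) ⊓ MulAction.stabilizer SL(9, ℂ) (E8.ofReal e) ⊓
    MulAction.stabilizer SL(9, ℂ) (E8.ofReal f)

lemma conjSL_smul_ofReal {g : SL(9, ℂ)} {x : E8 ℝ} (hg : g • E8.ofReal x = E8.ofReal x) :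
    conjSL g • E8.ofReal x = E8.ofReal x := by
  have := E8.map_smul_group (starRingEnd ℂ) g (E8.ofReal x)
  rw [hg] at this
  change E8.conj _ = conjSL g • E8.conj _ at this
  rw [E8.conj_ofReal] at this
  exact this.symm

lemma conjSL_mem_centralizer {h e f : E8 ℝ} {g : SL(9, ℂ)} (hg : g ∈ centralizer h e f) :
    conjSL g ∈ centralizer h e f :=
  ⟨⟨conjSL_smul_ofReal hg.1.1, conjSL_smul_ofReal hg.1.2⟩, conjSL_smul_ofReal hg.2⟩

/-- The stabilizer of a real triple, with the action of `Gal(ℂ/ℝ)` by complex conjugation. -/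
noncomputable def centralizerGamma (h e f : E8 ℝ) : GammaStructure (centralizer h e f) where
  σ := (conjSL.comp (centralizer h e f).subtype).codRestrict _
    fun g => conjSL_mem_centralizer g.2
  invol g := Subtype.ext (conjSL_conjSL _)

/-- The real points `(SL(9, ℂ) • e) ∩ 𝔤₁` of the complex orbit of `e`. -/
def realPoints (e : E8 ℝ) : Set (E8 ℝ) :=
  {x | x ∈ E8.gr (k := ℝ) 1 ∧ E8.ofReal x ∈ MulAction.orbit SL(9, ℂ) (E8.ofReal e)}

/-- The set of `SL(9, ℝ)`-orbits in `(SL(9, ℂ) • e) ∩ 𝔤₁`. -/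
def realOrbits (e : E8 ℝ) : Set (Set (E8 ℝ)) :=
  {O | ∃ x ∈ realPoints e, O = MulAction.orbit SL(9, ℝ) x}

end Trivector

/-!
Galois descent reduces the classification of the real orbits to two facts.

The first is that `H¹(ℝ, SL(9, ℂ))` is trivial (`exists_inv_mul_conjSL_eq`): every cocycle `c`
is of the form `g⁻¹ * conj g`. If `c` fixes the triple `(h, e, f)`, then `g` moves the triple to
another real homogeneous triple, and the orbit attached to `c` is that of `g • e`.

The second is that, over any field of characteristic zero, the stabilizer of `e` acts transitively
on the affine space of all `h'` in `[e, 𝔤₋₁]` with `[h', e] = 2 e`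
(`IsHomogeneousSl2Triple.exists_smul_eq`), while `h'` and `e` determine the third element of a
triple (`IsHomogeneousSl2Triple.eq_of_eq`). Over `ℝ` this shows that the map from cohomology
classes to orbits is injective: two real triples with the same `e` are conjugate under the real
stabilizer of `e`. Over `ℂ` it gives surjectivity: if `x = g • e` is real, then the affine space
attached to `x` is stable under complex conjugation, so it contains a real point, namely the real
part of `g • h`. Changing `g` by an element of the stabilizer of `x`, one may assume that `g • h` is
this real point. Then `g • f` is real as well by uniqueness, hence `g⁻¹ * conj g` fixes the triple.

For the transitivity, `h' - h` lies in `ker (ad e) ∩ im (ad e)`. If `e² y = 0`, then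
`e^(n+1) f^n y = (n+1)! (h - 1) ⋯ (h - n) e y` (`pow_succ_mul_pow_apply_sl2`), and `f` is nilpotent,
so `h' - h` is a sum of eigenvectors of `ad h` with positive integral eigenvalues. These eigenvectors
annihilate `e`. Conjugating with their exponentials, from the lowest weight upwards, moves `h` to
`h'` (`exists_conj_eq_add_of_mem_weightAnnGE`).
-/

namespace Trivector

/-! ### Identities for `𝔰𝔩₂`-triples of operators -/

section Sl2

open Polynomial in
/-- The polynomial `(X - 1) (X - 2) ⋯ (X - n)`. -/
noncomputable def shiftedProd (k : Type*) [CommRing k] (n : ℕ) : k[X] :=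
  ∏ j ∈ Finset.range n, (X - C ((j : k) + 1))

variable {k : Type*} [Field k] [CharZero k]

open Polynomial in
lemma shiftedProd_succ (n : ℕ) :
    shiftedProd k (n + 1) = shiftedProd k n * (X - C ((n : k) + 1)) :=
  Finset.prod_range_succ _ _

/-- The powers of `X` are eigenvectors of `ad H` with distinct eigenvalues `n * c` as long as they
do not vanish, so finitely many are nonzero. -/
lemma isNilpotent_of_commutator_eq_smul {A : Type*} [Ring A] [Algebra k A] [FiniteDimensional k A]
    {H X : A} {c : k} (hc : c ≠ 0) (h : H * X - X * H = c • X) : IsNilpotent X := by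
  by_contra hX
  have hpow : ∀ n : ℕ, H * X ^ n - X ^ n * H = (n * c : k) • X ^ n := by
    intro n
    induction n with
    | zero => simp
    | succ n ih =>
      have : H * X ^ (n + 1) - X ^ (n + 1) * H =
          (H * X ^ n - X ^ n * H) * X + X ^ n * (H * X - X * H) := by
        rw [pow_succ]; noncomm_ring
      rw [this, ih, h, smul_mul_assoc, mul_smul_comm, ← pow_succ, ← add_smul]
      congr 1
      push_cast
      ring
  let D : Module.End k A := LinearMap.mulLeft k H - LinearMap.mulRight k H
  have hev : ∀ n : ℕ, D.HasEigenvalue (n * c : k) := fun n =>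
    Module.End.hasEigenvalue_of_hasEigenvector (x := X ^ n)
      ⟨Module.End.mem_eigenspace_iff.mpr (hpow n), fun h0 => hX ⟨n, h0⟩⟩
  have hinj : Function.Injective fun n : ℕ => (n * c : k) := fun m n hmn =>
    Nat.cast_injective (mul_right_cancel₀ hc hmn)
  exact Set.infinite_of_injective_forall_mem hinj hev (Module.End.finite_hasEigenvalue D)

variable {V : Type*} [AddCommGroup V] [Module k V]

lemma commutator_pow_sl2 {H E F : Module.End k V} (hEF : E * F - F * E = H)
    (hHF : H * F - F * H = (-2 : k) • F) (n : ℕ) :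
    E * F ^ (n + 1) = F ^ (n + 1) * E + ((n : k) + 1) • (F ^ n * (H - (n : k) • 1)) := by
  have hHF' : H * F = F * H + (-2 : k) • F := by rw [← hHF]; abel
  have hEF' : E * F = F * E + H := by rw [← hEF]; abel
  induction n with
  | zero => simp [hEF']
  | succ n ih =>
    rw [pow_succ F (n + 1), ← mul_assoc, ih]
    simp only [pow_succ, add_mul, mul_add, sub_mul, mul_sub, smul_mul_assoc, mul_smul_comm,
      mul_assoc, mul_one, hEF', hHF']
    push_cast
    module

open Polynomial in
/-- On the kernel of `E`, the operator `E ^ (n + 1) F ^ (n + 1)` is a multiple of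
`H (H - 1) ⋯ (H - n)`. -/
lemma pow_mul_pow_apply_of_mem_ker {H E F : Module.End k V} (hEF : E * F - F * E = H)
    (hHE : H * E - E * H = (2 : k) • E) (hHF : H * F - F * H = (-2 : k) • F) (n : ℕ) :
    ∀ v : V, E v = 0 → (E ^ (n + 1)) ((F ^ (n + 1)) v) =
      ((n + 1).factorial : k) • aeval H (shiftedProd k n) (H v) := by
  induction n with
  | zero =>
    intro v hv
    have := LinearMap.congr_fun hEF v
    simp only [LinearMap.sub_apply, Module.End.mul_apply, hv, map_zero, sub_zero] at this
    simp [shiftedProd, this]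
  | succ n ih =>
    intro v hv
    have hH : E (H v) = 0 := by
      have := LinearMap.congr_fun hHE v
      simpa [hv] using this
    have hcomm := LinearMap.congr_fun (commutator_pow_sl2 hEF hHF (n + 1)) v
    simp only [LinearMap.add_apply, Module.End.mul_apply, LinearMap.smul_apply, hv, map_zero,
      zero_add] at hcomm
    rw [pow_succ E (n + 1), Module.End.mul_apply, hcomm, map_smul, ih _ (by simp [hH, hv]),
      shiftedProd_succ, map_mul, Module.End.mul_apply, Nat.factorial_succ (n + 1)]
    simp only [LinearMap.sub_apply, LinearMap.smul_apply, Module.End.one_apply, map_sub, aeval_X,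
      aeval_C, Module.algebraMap_end_apply, map_smul]
    push_cast
    module

/-- If `E ^ 2 y = 0`, then `E ^ (n + 1) F ^ n y` is a multiple of `(H - 1) ⋯ (H - n) E y`. -/
lemma pow_succ_mul_pow_apply_sl2 {H E F : Module.End k V} (hEF : E * F - F * E = H)
    (hHE : H * E - E * H = (2 : k) • E) (hHF : H * F - F * H = (-2 : k) • F) (n : ℕ) :
    ∀ y : V, E (E y) = 0 → (E ^ (n + 1)) ((F ^ n) y) =
      ((n + 1).factorial : k) • (Polynomial.aeval H (shiftedProd k n)) (E y) := by
  have hstep : ∀ (a : k) (x : V), E ((H - a • 1) x) = (H - (a + 2) • 1) (E x) := by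
    intro a x
    have := LinearMap.congr_fun hHE x
    simp only [LinearMap.sub_apply, Module.End.mul_apply, LinearMap.smul_apply,
      Module.End.one_apply, map_sub, map_smul] at this ⊢
    linear_combination (norm := module) -this
  have hstepH : ∀ y : V, E (E y) = 0 → E (H (E y)) = 0 := by
    intro y hy
    have := LinearMap.congr_fun hHE (E y)
    simpa [hy] using this
  induction n with
  | zero => intro y _; simp [shiftedProd]
  | succ n ih =>
    intro y hy
    have hHy := hstepH y hy
    have hcomm : (E ^ (n + 2)) ((F ^ (n + 1)) y) = (E ^ (n + 1)) ((F ^ (n + 1)) (E y)) +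
        ((n : k) + 1) • (E ^ (n + 1)) ((F ^ n) ((H - (n : k) • 1) y)) := by
      have := LinearMap.congr_fun (commutator_pow_sl2 hEF hHF n) y
      simp only [LinearMap.add_apply, Module.End.mul_apply, LinearMap.smul_apply] at this
      rw [pow_succ E (n + 1), Module.End.mul_apply, this, map_add, map_smul]
    rw [hcomm, pow_mul_pow_apply_of_mem_ker hEF hHE hHF n _ hy,
      ih _ (by rw [hstep, LinearMap.sub_apply, LinearMap.smul_apply, Module.End.one_apply, map_sub,
        map_smul, hHy, hy]; simp),
      hstep, shiftedProd_succ, map_mul, Module.End.mul_apply, Nat.factorial_succ (n + 1)]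
    simp only [LinearMap.sub_apply, LinearMap.smul_apply, Module.End.one_apply, map_sub,
      Polynomial.aeval_X, Polynomial.aeval_C, Module.algebraMap_end_apply, map_smul]
    push_cast
    module

/-- Vectors in `ker E ∩ im E` are sums of eigenvectors of `H` with positive integral eigenvalues:
they are killed by a polynomial in `H` whose roots are simple and positive integers. -/
lemma exists_aeval_shiftedProd_eq_zero [FiniteDimensional k V] {H E F : Module.End k V}
    (hEF : E * F - F * E = H) (hHE : H * E - E * H = (2 : k) • E)
    (hHF : H * F - F * H = (-2 : k) • F) :
    ∃ n : ℕ, ∀ y : V, E (E y) = 0 → Polynomial.aeval H (shiftedProd k n) (E y) = 0 := by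
  obtain ⟨n, hn⟩ := isNilpotent_of_commutator_eq_smul (by norm_num) hHF
  refine ⟨n, fun y hy => ?_⟩
  have h := pow_succ_mul_pow_apply_sl2 hEF hHE hHF n y hy
  rw [hn, LinearMap.zero_apply, map_zero] at h
  exact (smul_eq_zero.mp h.symm).resolve_left (Nat.cast_ne_zero.mpr (Nat.factorial_ne_zero _))

open Polynomial in
/-- A vector of an invariant subspace `p` that is killed by a product of distinct linear factors in
`H` is a sum of eigenvectors that again lie in `p`. -/
lemma mem_iSup_eigenspace_of_aeval_prod_eq_zero {H : Module.End k V} {p : Submodule k V}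
    (hp : ∀ x ∈ p, H x ∈ p) {ι : Type*} [DecidableEq ι] (s : Finset ι) (μ : ι → k)
    (hμ : Function.Injective μ) :
    ∀ w ∈ p, aeval H (∏ i ∈ s, (X - C (μ i))) w = 0 →
      w ∈ ⨆ i ∈ s, p ⊓ Module.End.eigenspace H (μ i) := by
  induction s using Finset.induction_on with
  | empty => intro w _ hw; simpa using hw
  | insert a s ha ih =>
    intro w hw h0
    rw [Finset.prod_insert ha, mul_comm, map_mul, Module.End.mul_apply] at h0
    have hsub : aeval H (X - C (μ a)) w = H w - μ a • w := by simp
    rw [hsub] at h0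
    have h1 := ih _ (p.sub_mem (hp w hw) (p.smul_mem _ hw)) h0
    -- `H - μ a` is onto on the sum of the other eigenspaces
    have hsurj : (⨆ i ∈ s, p ⊓ Module.End.eigenspace H (μ i)) ≤
        (⨆ i ∈ s, p ⊓ Module.End.eigenspace H (μ i)).map (H - μ a • 1) := by
      refine iSup₂_le fun i hi x hx => ?_
      have hne : μ i - μ a ≠ 0 := sub_ne_zero.mpr fun h => ha (hμ h ▸ hi)
      refine ⟨(μ i - μ a)⁻¹ • x, Submodule.smul_mem _ _
        (Submodule.mem_iSup_of_mem i (Submodule.mem_iSup_of_mem hi hx)), ?_⟩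
      have := Module.End.mem_eigenspace_iff.mp hx.2
      rw [map_smul, LinearMap.sub_apply, this, LinearMap.smul_apply, Module.End.one_apply,
        ← sub_smul, smul_smul, inv_mul_cancel₀ hne, one_smul]
    obtain ⟨x, hx, hxw⟩ := hsurj h1
    have hxp : x ∈ p := (iSup₂_le fun i _ => inf_le_left : _ ≤ p) hx
    have hwx : w - x ∈ p ⊓ Module.End.eigenspace H (μ a) := by
      refine ⟨p.sub_mem hw hxp, Module.End.mem_eigenspace_iff.mpr ?_⟩
      simp only [LinearMap.sub_apply, LinearMap.smul_apply, Module.End.one_apply] at hxw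
      rw [map_sub, smul_sub, sub_eq_sub_iff_sub_eq_sub, hxw]
    rw [Finset.iSup_insert, ← sub_add_cancel w x]
    exact Submodule.add_mem_sup hwx hx

end Sl2

/-! ### Exponentials of nilpotent matrices acting on tensors -/

section Exp

open IsNilpotent (exp)

variable {k : Type*} [Field k]

lemma det_one_add_of_isNilpotent {n : Type*} [Fintype n] [DecidableEq n] {N : Matrix n n k}
    (hN : IsNilpotent N) : (1 + N).det = 1 := by
  have h : N.charpoly = Polynomial.X ^ Fintype.card n :=
    sub_eq_zero.mp (Matrix.isNilpotent_charpoly_sub_pow_of_isNilpotent hN).eq_zero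
  have h1 := congrArg (Polynomial.eval (-1 : k)) h
  rw [Matrix.eval_charpoly, Polynomial.eval_pow, Polynomial.eval_X] at h1
  have h2 : Matrix.scalar n (-1 : k) - N = -(1 + N) := by
    rw [map_neg, map_one]; abel
  rw [h2, Matrix.det_neg] at h1
  exact mul_left_cancel₀ (pow_ne_zero _ (neg_ne_zero.mpr one_ne_zero)) (h1.trans (mul_one _).symm)

/-- A matrix acting on the first index of a tensor. -/
def actFst : Matrix (Fin 9) (Fin 9) k →+* Module.End k (Tensor k) where
  toFun g :=
    { toFun := fun v i j l => ∑ p, g i p * v p j l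
      map_add' := fun v w => by funext i j l; simp [mul_add, Finset.sum_add_distrib]
      map_smul' := fun c v => by funext i j l; simp [Finset.mul_sum, mul_left_comm] }
  map_one' := by ext; simp [Matrix.one_apply]
  map_mul' g h := by
    refine LinearMap.ext fun v => ?_
    funext i j l
    change ∑ p, (g * h) i p * v p j l = ∑ p, g i p * ∑ q, h p q * v q j l
    simp only [Matrix.mul_apply, Finset.sum_mul, Finset.mul_sum, mul_assoc]
    exact Finset.sum_comm
  map_zero' := by
    refine LinearMap.ext fun v => ?_
    funext i j l
    simp
  map_add' g h := by
    refine LinearMap.ext fun v => ?_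
    funext i j l
    simp [add_mul, Finset.sum_add_distrib]

/-- A matrix acting on the second index of a tensor. -/
def actSnd : Matrix (Fin 9) (Fin 9) k →+* Module.End k (Tensor k) where
  toFun g :=
    { toFun := fun v i j l => ∑ p, g j p * v i p l
      map_add' := fun v w => by funext i j l; simp [mul_add, Finset.sum_add_distrib]
      map_smul' := fun c v => by funext i j l; simp [Finset.mul_sum, mul_left_comm] }
  map_one' := by
    refine LinearMap.ext fun v => ?_
    funext i j l
    simp [Matrix.one_apply]
  map_mul' g h := by
    refine LinearMap.ext fun v => ?_
    funext i j l
    change ∑ p, (g * h) j p * v i p l = ∑ p, g j p * ∑ q, h p q * v i q l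
    simp only [Matrix.mul_apply, Finset.sum_mul, Finset.mul_sum, mul_assoc]
    exact Finset.sum_comm
  map_zero' := by
    refine LinearMap.ext fun v => ?_
    funext i j l
    simp
  map_add' g h := by
    refine LinearMap.ext fun v => ?_
    funext i j l
    simp [add_mul, Finset.sum_add_distrib]

/-- A matrix acting on the third index of a tensor. -/
def actThd : Matrix (Fin 9) (Fin 9) k →+* Module.End k (Tensor k) where
  toFun g :=
    { toFun := fun v i j l => ∑ p, g l p * v i j p
      map_add' := fun v w => by funext i j l; simp [mul_add, Finset.sum_add_distrib]
      map_smul' := fun c v => by funext i j l; simp [Finset.mul_sum, mul_left_comm] }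
  map_one' := by
    refine LinearMap.ext fun v => ?_
    funext i j l
    simp [Matrix.one_apply]
  map_mul' g h := by
    refine LinearMap.ext fun v => ?_
    funext i j l
    change ∑ p, (g * h) l p * v i j p = ∑ p, g l p * ∑ q, h p q * v i j q
    simp only [Matrix.mul_apply, Finset.sum_mul, Finset.mul_sum, mul_assoc]
    exact Finset.sum_comm
  map_zero' := by
    refine LinearMap.ext fun v => ?_
    funext i j l
    simp
  map_add' g h := by
    refine LinearMap.ext fun v => ?_
    funext i j l
    simp [add_mul, Finset.sum_add_distrib]

lemma commute_actFst_actSnd (g h : Matrix (Fin 9) (Fin 9) k) :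
    Commute (actFst g) (actSnd h) := by
  refine LinearMap.ext fun v => ?_
  funext i j l
  change ∑ p, g i p * ∑ q, h j q * v p q l = ∑ q, h j q * ∑ p, g i p * v p q l
  simp only [Finset.mul_sum, mul_left_comm (g _ _)]
  exact Finset.sum_comm

lemma commute_actFst_actThd (g h : Matrix (Fin 9) (Fin 9) k) :
    Commute (actFst g) (actThd h) := by
  refine LinearMap.ext fun v => ?_
  funext i j l
  change ∑ p, g i p * ∑ q, h l q * v p j q = ∑ q, h l q * ∑ p, g i p * v p j q
  simp only [Finset.mul_sum, mul_left_comm (g _ _)]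
  exact Finset.sum_comm

lemma commute_actSnd_actThd (g h : Matrix (Fin 9) (Fin 9) k) :
    Commute (actSnd g) (actThd h) := by
  refine LinearMap.ext fun v => ?_
  funext i j l
  change ∑ p, g j p * ∑ q, h l q * v i p q = ∑ q, h l q * ∑ p, g j p * v i p q
  simp only [Finset.mul_sum, mul_left_comm (g _ _)]
  exact Finset.sum_comm

lemma matAct_eq_act (g : Matrix (Fin 9) (Fin 9) k) (v : Tensor k) :
    matAct g v = (actFst g * (actSnd g * actThd g)) v := by
  funext i j l
  change ∑ p, ∑ q, ∑ r, g i p * g j q * g l r * v p q r =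
    ∑ p, g i p * ∑ q, g j q * ∑ r, g l r * v p q r
  simp only [Finset.mul_sum, mul_assoc]

lemma lieAct_eq_act (X : Matrix (Fin 9) (Fin 9) k) (v : Tensor k) :
    lieAct X v = (actFst X + (actSnd X + actThd X)) v := by
  funext i j l
  change ∑ p, (X i p * v p j l + X j p * v i p l + X l p * v i j p) =
    ∑ p, X i p * v p j l + (∑ p, X j p * v i p l + ∑ p, X l p * v i j p)
  simp only [Finset.sum_add_distrib, add_assoc]

variable [CharZero k]

/-- An infinitesimal stabilizer exponentiates to the stabilizer: `matAct (exp X)` is the exponential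
of `lieAct X`, since `X` acts on the three tensor factors by commuting operators. -/
lemma matAct_exp_of_lieAct_eq_zero {X : Matrix (Fin 9) (Fin 9) k} (hX : IsNilpotent X)
    {v : Tensor k} (hv : lieAct X v = 0) : matAct (exp X) v = v := by
  have h2 : IsNilpotent (actSnd X + actThd X) :=
    (commute_actSnd_actThd X X).isNilpotent_add (hX.map actSnd) (hX.map actThd)
  have hc : Commute (actFst X) (actSnd X + actThd X) :=
    (commute_actFst_actSnd X X).add_right (commute_actFst_actThd X X)
  rw [matAct_eq_act, IsNilpotent.map_exp hX actFst, IsNilpotent.map_exp hX actSnd,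
    IsNilpotent.map_exp hX actThd, ← IsNilpotent.exp_add_of_commute (commute_actSnd_actThd X X)
      (hX.map actSnd) (hX.map actThd), ← IsNilpotent.exp_add_of_commute hc (hX.map actFst) h2]
  rw [lieAct_eq_act] at hv
  have := IsNilpotent.exp_smul_eq_sum (k := 1) (m := v) (by rw [pow_one]; exact hv)
    (hc.isNilpotent_add (hX.map actFst) h2)
  simpa using this

section Conj

variable {A : Type*} [Ring A] [Algebra k A]

/-- The operator `Y ↦ X * Y - Y * X`. -/
def adOp (X : A) : Module.End k A := LinearMap.mulLeft k X - LinearMap.mulRight k X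

lemma adOp_apply (X Y : A) : adOp (k := k) X Y = X * Y - Y * X := rfl

lemma isNilpotent_adOp {X : A} (hX : IsNilpotent X) : IsNilpotent (adOp (k := k) X) := by
  obtain ⟨n, hn⟩ := hX
  refine (LinearMap.commute_mulLeft_right X X).isNilpotent_sub ⟨n, ?_⟩ ⟨n, ?_⟩
  · rw [LinearMap.pow_mulLeft, hn, LinearMap.mulLeft_zero_eq_zero]
  · rw [LinearMap.pow_mulRight, hn, LinearMap.mulRight_zero_eq_zero]

variable [Algebra ℚ A]

lemma exp_mulLeft {X : A} (hX : IsNilpotent X) :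
    exp (LinearMap.mulLeft k X) = LinearMap.mulLeft k (exp X) := by
  obtain ⟨n, hn⟩ := hX
  refine LinearMap.ext fun Y => ?_
  rw [IsNilpotent.exp_eq_sum hn, IsNilpotent.exp_eq_sum (k := n)
    (by rw [LinearMap.pow_mulLeft, hn, LinearMap.mulLeft_zero_eq_zero])]
  simp [LinearMap.sum_apply, Finset.sum_mul, LinearMap.pow_mulLeft]

lemma exp_mulRight {X : A} (hX : IsNilpotent X) :
    exp (LinearMap.mulRight k X) = LinearMap.mulRight k (exp X) := by
  obtain ⟨n, hn⟩ := hX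
  refine LinearMap.ext fun Y => ?_
  rw [IsNilpotent.exp_eq_sum hn, IsNilpotent.exp_eq_sum (k := n)
    (by rw [LinearMap.pow_mulRight, hn, LinearMap.mulRight_zero_eq_zero])]
  simp [LinearMap.sum_apply, Finset.mul_sum, LinearMap.pow_mulRight]

lemma exp_mul_mul_exp_neg {X : A} (hX : IsNilpotent X) (Y : A) :
    exp X * Y * exp (-X) = exp (adOp (k := k) X) Y := by
  have h : adOp (k := k) X = LinearMap.mulLeft k X + LinearMap.mulRight k (-X) := by
    refine LinearMap.ext fun Z => ?_
    simp [adOp_apply, sub_eq_add_neg]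
  have hl : IsNilpotent (LinearMap.mulLeft k X) := by
    obtain ⟨n, hn⟩ := hX
    exact ⟨n, by rw [LinearMap.pow_mulLeft, hn, LinearMap.mulLeft_zero_eq_zero]⟩
  have hr : IsNilpotent (LinearMap.mulRight k (-X)) := by
    obtain ⟨n, hn⟩ := hX.neg
    exact ⟨n, by rw [LinearMap.pow_mulRight, hn, LinearMap.mulRight_zero_eq_zero]⟩
  rw [h, IsNilpotent.exp_add_of_commute (LinearMap.commute_mulLeft_right X (-X)) hl hr,
    exp_mulLeft hX, exp_mulRight hX.neg]
  simp [mul_assoc]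

lemma exp_mul_mul_exp_neg_mem {X : A} (hX : IsNilpotent X) {S : Submodule k A}
    (hS : ∀ Y ∈ S, X * Y - Y * X ∈ S) {Y : A} (hY : Y ∈ S) : exp X * Y * exp (-X) ∈ S := by
  rw [exp_mul_mul_exp_neg (k := k) hX, IsNilpotent.exp, LinearMap.sum_apply]
  refine S.sum_mem fun i _ => ?_
  have hpow : ∀ i : ℕ, ((adOp (k := k) X) ^ i) Y ∈ S := fun i => by
    induction i with
    | zero => exact hY
    | succ i ih =>
      rw [pow_succ', Module.End.mul_apply]
      exact hS _ ih
  rw [LinearMap.smul_apply, ← Rat.cast_smul_eq_qsmul k]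
  exact S.smul_mem _ (hpow i)

lemma exp_mul_mul_exp_neg_eq_sub {X Y : A} (hX : IsNilpotent X) {c : k}
    (h : Y * X - X * Y = c • X) : exp X * Y * exp (-X) = Y - c • X := by
  have h1 : adOp (k := k) X Y = -(c • X) := by rw [adOp_apply, ← h, neg_sub]
  have h2 := IsNilpotent.exp_smul_eq_sum (a := adOp (k := k) X) (m := Y) (k := 2)
    (by rw [pow_two, Module.End.smul_def, Module.End.mul_apply, h1, map_neg, map_smul, adOp_apply]
        simp) (isNilpotent_adOp hX)
  rw [exp_mul_mul_exp_neg (k := k) hX, ← Module.End.smul_def, h2]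
  simp [Finset.sum_range_succ, h1, sub_eq_add_neg]

end Conj

/-- The exponential of a nilpotent matrix, as an element of the special linear group. -/
noncomputable def expSL {X : Matrix (Fin 9) (Fin 9) k} (hX : IsNilpotent X) : SL(9, k) :=
  ⟨exp X, by
    rw [← add_sub_cancel 1 (exp X)]
    exact det_one_add_of_isNilpotent (IsNilpotent.isNilpotent_exp_sub_one hX)⟩

lemma expSL_val {X : Matrix (Fin 9) (Fin 9) k} (hX : IsNilpotent X) : (expSL hX).1 = exp X := rfl

lemma expSL_inv_val {X : Matrix (Fin 9) (Fin 9) k} (hX : IsNilpotent X) :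
    (expSL hX)⁻¹.1 = exp (-X) := by
  have : (expSL hX)⁻¹ = expSL hX.neg := by
    refine inv_eq_of_mul_eq_one_right (Subtype.ext ?_)
    exact IsNilpotent.exp_mul_exp_neg_self hX
  rw [this, expSL_val]

end Exp

/-! ### Conjugation by elements of positive weight -/

section Conjugacy

open IsNilpotent (exp)

variable {k : Type*} [Field k] [CharZero k]

/-- The matrices of weight `m` with respect to `ad H` that annihilate the tensor `v`. -/
def weightAnn (H : Matrix (Fin 9) (Fin 9) k) (v : Tensor k) (m : ℕ) :
    Submodule k (Matrix (Fin 9) (Fin 9) k) where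
  carrier := {X | lieAct X v = 0 ∧ H * X - X * H = (m : k) • X}
  add_mem' {X Y} hX hY := ⟨by rw [add_lieAct, hX.1, hY.1, add_zero], by
    rw [mul_add, add_mul, smul_add, ← hX.2, ← hY.2]; abel⟩
  zero_mem' := ⟨by funext i j l; simp [lieAct], by simp⟩
  smul_mem' c X hX := ⟨by rw [smul_lieAct, hX.1, smul_zero], by
    rw [mul_smul_comm, smul_mul_assoc, ← smul_sub, hX.2, smul_comm]⟩

lemma commutator_mem_weightAnn {H : Matrix (Fin 9) (Fin 9) k} {v : Tensor k} {m n : ℕ}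
    {X Y : Matrix (Fin 9) (Fin 9) k} (hX : X ∈ weightAnn H v m) (hY : Y ∈ weightAnn H v n) :
    X * Y - Y * X ∈ weightAnn H v (m + n) := by
  refine ⟨?_, ?_⟩
  · have hz : ∀ Z : Matrix (Fin 9) (Fin 9) k, lieAct Z 0 = 0 := fun Z => by
      funext i j l; simp [lieAct]
    rw [lieAct_lieAct, hX.1, hY.1, hz, hz, sub_zero]
  · have e : H * (X * Y - Y * X) - (X * Y - Y * X) * H =
        ((H * X - X * H) * Y - Y * (H * X - X * H)) +
          (X * (H * Y - Y * H) - (H * Y - Y * H) * X) := by noncomm_ring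
    rw [e, hX.2, hY.2]
    simp only [smul_mul_assoc, mul_smul_comm]
    push_cast
    module

/-- The sum of the weight spaces of weight at least `m`. -/
def weightAnnGE (H : Matrix (Fin 9) (Fin 9) k) (v : Tensor k) (m : ℕ) :
    Submodule k (Matrix (Fin 9) (Fin 9) k) := ⨆ j ≥ m, weightAnn H v j

lemma weightAnn_le_weightAnnGE (H : Matrix (Fin 9) (Fin 9) k) (v : Tensor k) {m j : ℕ}
    (h : m ≤ j) : weightAnn H v j ≤ weightAnnGE H v m :=
  le_iSup₂_of_le j h le_rfl

lemma weightAnnGE_le_sup (H : Matrix (Fin 9) (Fin 9) k) (v : Tensor k) (m : ℕ) :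
    weightAnnGE H v m ≤ weightAnn H v m ⊔ weightAnnGE H v (m + 1) := by
  refine iSup₂_le fun j hj => ?_
  rcases eq_or_lt_of_le hj with rfl | hlt
  · exact le_sup_left
  · exact (weightAnn_le_weightAnnGE H v hlt).trans le_sup_right

lemma commutator_mem_weightAnnGE {H : Matrix (Fin 9) (Fin 9) k} {v : Tensor k} {m n : ℕ}
    {X Y : Matrix (Fin 9) (Fin 9) k} (hX : X ∈ weightAnn H v m) (hY : Y ∈ weightAnnGE H v n) :
    X * Y - Y * X ∈ weightAnnGE H v n := by
  have : weightAnnGE H v n ≤ (weightAnnGE H v n).comap (adOp (k := k) X) :=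
    iSup₂_le fun j hj Z hZ => weightAnn_le_weightAnnGE H v (Nat.le_add_left_of_le hj)
      (commutator_mem_weightAnn hX hZ)
  exact this hY

lemma exists_weightAnn_eq_bot (H : Matrix (Fin 9) (Fin 9) k) (v : Tensor k) :
    ∃ M : ℕ, ∀ j ≥ M, weightAnn H v j = ⊥ := by
  have hfin : {j : ℕ | (adOp (k := k) H).HasEigenvalue (j : k)}.Finite :=
    (Module.End.finite_hasEigenvalue (adOp (k := k) H)).preimage Nat.cast_injective.injOn
  obtain ⟨M, hM⟩ := hfin.bddAbove
  refine ⟨M + 1, fun j hj => (Submodule.eq_bot_iff _).mpr fun X hX => ?_⟩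
  by_contra h0
  have : j ≤ M := hM (Module.End.hasEigenvalue_of_hasEigenvector (x := X)
    ⟨Module.End.mem_eigenspace_iff.mpr hX.2, h0⟩)
  omega

/-- Translating `H` by an element of positive weight in the annihilator of `v` is the effect of
a conjugation that fixes `v`. The translation is removed weight by weight: the component of lowest
weight `m` is removed by conjugating with its exponential, up to the factor `1 / m`. -/
lemma exists_conj_eq_add_of_mem_weightAnnGE (H : Matrix (Fin 9) (Fin 9) k) (v : Tensor k)
    {m : ℕ} (hm : 0 < m) {w : Matrix (Fin 9) (Fin 9) k} (hw : w ∈ weightAnnGE H v m) :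
    ∃ u : SL(9, k), matAct u.1 v = v ∧ u.1 * H * u⁻¹.1 = H + w := by
  obtain ⟨M, hM⟩ := exists_weightAnn_eq_bot H v
  obtain ⟨n, hn⟩ : ∃ n, M ≤ m + n := ⟨M, Nat.le_add_left _ _⟩
  induction n generalizing m w with
  | zero =>
    have : weightAnnGE H v m = ⊥ :=
      (eq_bot_iff.mpr (iSup₂_le fun j hj => (hM j (by omega)).le))
    rw [this, Submodule.mem_bot] at hw
    exact ⟨1, matAct_one v, by simp [hw]⟩
  | succ n ih =>
    obtain ⟨x, hx, y, hy, rfl⟩ := Submodule.mem_sup.mp (weightAnnGE_le_sup H v m hw)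
    have hm0 : (m : k) ≠ 0 := Nat.cast_ne_zero.mpr hm.ne'
    have hX : (m : k)⁻¹ • x ∈ weightAnn H v m := Submodule.smul_mem _ _ hx
    have hnil : IsNilpotent ((m : k)⁻¹ • x) := isNilpotent_of_commutator_eq_smul hm0 hX.2
    have hconjH := exp_mul_mul_exp_neg_eq_sub hnil hX.2
    have hconjx : exp ((m : k)⁻¹ • x) * x * exp (-((m : k)⁻¹ • x)) = x := by
      simpa using exp_mul_mul_exp_neg_eq_sub (Y := x) (c := (0 : k)) hnil (by simp)
    have hconjy : exp ((m : k)⁻¹ • x) * y * exp (-((m : k)⁻¹ • x)) ∈ weightAnnGE H v (m + 1) :=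
      exp_mul_mul_exp_neg_mem hnil (fun Y hY => commutator_mem_weightAnnGE hX hY) hy
    obtain ⟨u, huv, huH⟩ := ih (Nat.succ_pos m) hconjy (by omega)
    have hfix : matAct (expSL hnil).1 v = v := matAct_exp_of_lieAct_eq_zero hnil hX.1
    refine ⟨(expSL hnil)⁻¹ * u, ?_, ?_⟩
    · rw [Matrix.SpecialLinearGroup.coe_mul, matAct_mul, huv]
      conv_lhs => rw [← hfix, ← matAct_mul, ← Matrix.SpecialLinearGroup.coe_mul, inv_mul_cancel,
        Matrix.SpecialLinearGroup.coe_one, matAct_one]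
    · have hall : (expSL hnil).1 * (H + (x + y)) * (expSL hnil)⁻¹.1 = u.1 * H * u⁻¹.1 := by
        rw [huH, expSL_val, expSL_inv_val, mul_add, mul_add, add_mul, add_mul, hconjH, hconjx,
          smul_smul, mul_inv_cancel₀ hm0, one_smul]
        abel
      have hl : (expSL hnil)⁻¹.1 * (expSL hnil).1 = 1 := by
        rw [← Matrix.SpecialLinearGroup.coe_mul, inv_mul_cancel, Matrix.SpecialLinearGroup.coe_one]
      rw [mul_inv_rev, inv_inv, Matrix.SpecialLinearGroup.coe_mul,
        Matrix.SpecialLinearGroup.coe_mul]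
      calc _ = (expSL hnil)⁻¹.1 * (u.1 * H * u⁻¹.1) * (expSL hnil).1 := by
            simp only [mul_assoc]
        _ = ((expSL hnil)⁻¹.1 * (expSL hnil).1) * (H + (x + y)) *
            ((expSL hnil)⁻¹.1 * (expSL hnil).1) := by
            rw [← hall]; simp only [mul_assoc]
        _ = _ := by rw [hl, one_mul, mul_one]

end Conjugacy

/-! ### Equivariance of the structure maps -/

section Equivariance

variable {k : Type*} [Field k]

lemma lieAct_matAct {g g' X : Matrix (Fin 9) (Fin 9) k} (hg : g' * g = 1) (v : Tensor k) :
    lieAct (g * X * g') (matAct g v) = matAct g (lieAct X v) := by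
  have key : ∀ φ : Matrix (Fin 9) (Fin 9) k →+* Module.End k (Tensor k),
      φ (g * X * g') * φ g = φ g * φ X := fun φ => by
    rw [← map_mul, ← map_mul, mul_assoc, hg, mul_one]
  rw [lieAct_eq_act, matAct_eq_act, matAct_eq_act, lieAct_eq_act, ← Module.End.mul_apply,
    ← Module.End.mul_apply]
  congr 1
  generalize g * X * g' = Y at key ⊢
  have e1 : ∀ t, actFst Y * (actFst g * t) = actFst g * (actFst X * t) := fun t => by
    rw [← mul_assoc, key, mul_assoc]
  have e2 : ∀ t, actSnd Y * (actSnd g * t) = actSnd g * (actSnd X * t) := fun t => by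
    rw [← mul_assoc, key, mul_assoc]
  -- each summand is moved to its own tensor factor, past the two factors it commutes with
  simp only [add_mul, mul_add, mul_assoc]
  rw [e1, (commute_actFst_actSnd g Y).symm.left_comm, e2,
    (commute_actFst_actThd g Y).symm.left_comm,
    (commute_actSnd_actThd g Y).symm.left_comm, key,
    (commute_actFst_actSnd X g).left_comm, (commute_actFst_actThd X g).eq,
    (commute_actSnd_actThd X g).eq]

variable [CharZero k]

lemma contract_actFst_left (g : Matrix (Fin 9) (Fin 9) k) (v w : Tensor k) :
    contract (actFst g v) w = g * contract v w := by
  ext i j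
  change (1 / 2) * ∑ p, ∑ q, (∑ r, g i r * v r p q) * w j p q =
    ∑ r, g i r * ((1 / 2) * ∑ p, ∑ q, v r p q * w j p q)
  simp only [Finset.sum_mul, Finset.mul_sum]
  conv_rhs => rw [Finset.sum_comm]
  refine Finset.sum_congr rfl fun p _ => ?_
  rw [Finset.sum_comm]
  exact Finset.sum_congr rfl fun _ _ => Finset.sum_congr rfl fun _ _ => by ring

lemma contract_actFst_right (g : Matrix (Fin 9) (Fin 9) k) (v w : Tensor k) :
    contract v (actFst g w) = contract v w * g.transpose := by
  rw [← contract_transpose, contract_actFst_left, Matrix.transpose_mul, contract_transpose]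

lemma contract_actSnd (g : Matrix (Fin 9) (Fin 9) k) (v w : Tensor k) :
    contract (actSnd g v) w = contract v (actSnd g.transpose w) := by
  ext i j
  change (1 / 2) * ∑ p, ∑ q, (∑ r, g p r * v i r q) * w j p q =
    (1 / 2) * ∑ p, ∑ q, v i p q * (∑ r, g r p * w j r q)
  simp only [Finset.sum_mul, Finset.mul_sum]
  rw [Finset.sum_comm]
  conv_rhs => rw [Finset.sum_comm]
  refine Finset.sum_congr rfl fun q _ => ?_
  rw [Finset.sum_comm]
  exact Finset.sum_congr rfl fun _ _ => Finset.sum_congr rfl fun _ _ => by ring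

lemma contract_actThd (g : Matrix (Fin 9) (Fin 9) k) (v w : Tensor k) :
    contract (actThd g v) w = contract v (actThd g.transpose w) := by
  ext i j
  change (1 / 2) * ∑ p, ∑ q, (∑ r, g q r * v i p r) * w j p q =
    (1 / 2) * ∑ p, ∑ q, v i p q * (∑ r, g r q * w j p r)
  simp only [Finset.sum_mul, Finset.mul_sum]
  refine Finset.sum_congr rfl fun p _ => ?_
  rw [Finset.sum_comm]
  exact Finset.sum_congr rfl fun _ _ => Finset.sum_congr rfl fun _ _ => by ring

lemma contract_matAct {g g' : Matrix (Fin 9) (Fin 9) k} (hg : g' * g = 1) (v w : Tensor k) :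
    contract (matAct g v) (matAct g'.transpose w) = g * contract v w * g' := by
  have ht : g.transpose * g'.transpose = 1 := by
    rw [← Matrix.transpose_mul, hg, Matrix.transpose_one]
  rw [matAct_eq_act, matAct_eq_act]
  simp only [Module.End.mul_apply]
  rw [contract_actFst_left, contract_actFst_right, contract_actSnd, ← Module.End.mul_apply,
    ← map_mul, ht, map_one, Module.End.one_apply, contract_actThd, ← Module.End.mul_apply,
    ← map_mul, ht, map_one, Module.End.one_apply, Matrix.transpose_transpose, mul_assoc]

lemma moment_matAct {g g' : Matrix (Fin 9) (Fin 9) k} (hg : g' * g = 1) (v w : Tensor k) :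
    moment (matAct g v) (matAct g'.transpose w) = g * moment v w * g' := by
  rw [moment, moment, contract_matAct hg, traceless, traceless, mul_assoc,
    Matrix.trace_mul_comm, mul_assoc, hg, mul_one, mul_sub, sub_mul, mul_smul_comm, smul_mul_assoc,
    mul_one, mul_eq_one_comm.mp hg, mul_assoc]

end Equivariance

/-! ### The action of `SL(9)` on the graded Lie algebra -/

section GroupAction

variable {k : Type*} [Field k]

lemma coe_inv_mul_coe (g : SL(9, k)) : (g⁻¹).1 * g.1 = 1 := by
  rw [← Matrix.SpecialLinearGroup.coe_mul, inv_mul_cancel, Matrix.SpecialLinearGroup.coe_one]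

lemma matAct_smul (g : Matrix (Fin 9) (Fin 9) k) (c : k) (v : Tensor k) :
    matAct g (c • v) = c • matAct g v := by simp only [matAct_eq_act, map_smul]

lemma matAct_zero (g : Matrix (Fin 9) (Fin 9) k) : matAct g (0 : Tensor k) = 0 := by
  simp only [matAct_eq_act, map_zero]

namespace E8

lemma group_smul_smul (g : SL(9, k)) (c : k) (x : E8 k) : g • (c • x) = c • (g • x) := by
  refine ext_val ?_ (matAct_smul _ _ _) (matAct_smul _ _ _)
  change g.1 * (c • x.zero.1) * (g⁻¹).1 = c • (g.1 * x.zero.1 * (g⁻¹).1)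
  rw [mul_smul_comm, smul_mul_assoc]

variable [CharZero k]

lemma mem_gr_zero {x : E8 k} : x ∈ gr (k := k) 0 ↔ x.one = 0 ∧ x.negOne = 0 := by
  constructor
  · exact fun h => ⟨h.2.1 (by decide), h.2.2 (by decide)⟩
  · exact fun h => ⟨fun h0 => absurd rfl h0, fun _ => h.1, fun _ => h.2⟩

lemma mem_gr_one {x : E8 k} : x ∈ gr (k := k) 1 ↔ x.zero = 0 ∧ x.negOne = 0 := by
  constructor
  · exact fun h => ⟨h.1 (by decide), h.2.2 (by decide)⟩
  · exact fun h => ⟨fun _ => h.1, fun h0 => absurd rfl h0, fun _ => h.2⟩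

lemma mem_gr_negOne {x : E8 k} : x ∈ gr (k := k) (-1) ↔ x.zero = 0 ∧ x.one = 0 := by
  constructor
  · exact fun h => ⟨h.1 (by decide), h.2.1 (by decide)⟩
  · exact fun h => ⟨fun _ => h.1, fun _ => h.2, fun h0 => absurd rfl h0⟩

lemma smul_mem_gr (g : SL(9, k)) {d : ZMod 3} {x : E8 k} (hx : x ∈ gr (k := k) d) :
    g • x ∈ gr (k := k) d := by
  refine ⟨fun h => Subtype.ext ?_, fun h => Subtype.ext ?_, fun h => Subtype.ext ?_⟩
  · rw [smul_zero_val, hx.1 h]; simp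
  · rw [smul_one_val, hx.2.1 h]; exact matAct_zero _
  · rw [smul_negOne_val, hx.2.2 h]; exact matAct_zero _

/-- For `h` of degree `0` only the terms of the bracket that are linear in `𝔤₀` survive. -/
lemma lie_eq_of_mem_gr_zero {h : E8 k} (hh : h ∈ gr (k := k) 0) (x : E8 k) :
    (⁅h, x⁆ : E8 k).zero.1 = h.zero.1 * x.zero.1 - x.zero.1 * h.zero.1 ∧
    (⁅h, x⁆ : E8 k).one.1 = lieAct h.zero.1 x.one.1 ∧
    (⁅h, x⁆ : E8 k).negOne.1 = lieAct (-h.zero.1.transpose) x.negOne.1 := by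
  obtain ⟨h1, h2⟩ := mem_gr_zero.mp hh
  have m1 : ∀ v : Tensor k, moment 0 v = 0 := fun v => by
    simpa using moment_smul_left (0 : k) 0 v
  have m2 : ∀ v : Tensor k, moment v 0 = 0 := fun v => by
    simpa using moment_smul_right (0 : k) v 0
  have m3 : ∀ v : Tensor k, cross 0 v = 0 := fun v => by simpa using cross_smul (0 : k) 0 v
  have m4 : ∀ A : Matrix (Fin 9) (Fin 9) k, lieAct A 0 = 0 := fun A => by
    simpa using lieAct_smul A (0 : k) 0
  refine ⟨?_, ?_, ?_⟩
  · rw [lie_zero_val, br0, h1, h2]; simp [m1, m2]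
  · rw [lie_one_val, br1, h1, h2]; simp [m3, m4]
  · rw [lie_negOne_val, brN, h1, h2]; simp [m3, m4]

lemma lie_mem_gr_zero {x y : E8 k} (hx : x ∈ gr (k := k) 1) (hy : y ∈ gr (k := k) (-1)) :
    ⁅x, y⁆ ∈ gr (k := k) 0 ∧ (⁅x, y⁆ : E8 k).zero.1 = moment x.one.1 y.negOne.1 := by
  obtain ⟨h1, h2⟩ := mem_gr_one.mp hx
  obtain ⟨h3, h4⟩ := mem_gr_negOne.mp hy
  have m2 : ∀ v : Tensor k, moment v 0 = 0 := fun v => by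
    simpa using moment_smul_right (0 : k) v 0
  have m3 : ∀ v : Tensor k, cross 0 v = 0 := fun v => by simpa using cross_smul (0 : k) 0 v
  have m5 : ∀ v : Tensor k, cross v 0 = 0 := fun v => by
    simpa using cross_smul_right (0 : k) v 0
  have m4 : ∀ v : Tensor k, lieAct 0 v = 0 := fun v => by
    simpa using smul_lieAct (0 : k) 0 v
  refine ⟨mem_gr_zero.mpr ⟨Subtype.ext ?_, Subtype.ext ?_⟩, ?_⟩
  · rw [lie_one_val, br1, h1, h2, h3, h4]; simp [m3, m4]
  · rw [lie_negOne_val, brN, h1, h2, h3, h4]; simp [m5, m4]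
  · rw [lie_zero_val, br0, h1, h2, h3, h4]; simp [m2]

lemma smul_lie_of_mem_gr_zero (g : SL(9, k)) {h : E8 k} (hh : h ∈ gr (k := k) 0) (x : E8 k) :
    ⁅g • h, g • x⁆ = g • ⁅h, x⁆ := by
  obtain ⟨a0, a1, a2⟩ := lie_eq_of_mem_gr_zero hh x
  obtain ⟨b0, b1, b2⟩ := lie_eq_of_mem_gr_zero (smul_mem_gr g hh) (g • x)
  refine ext_val (b0.trans ?_) (b1.trans ?_) (b2.trans ?_)
  · rw [smul_zero_val, smul_zero_val, smul_zero_val, a0, mul_sub, sub_mul]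
    simp only [mul_assoc]
    rw [← mul_assoc (g⁻¹).1 g.1, coe_inv_mul_coe, one_mul, ← mul_assoc (g⁻¹).1 g.1,
      coe_inv_mul_coe, one_mul]
  · rw [smul_zero_val, smul_one_val, smul_one_val, a1, lieAct_matAct (coe_inv_mul_coe g)]
  · have ht : g.1.transpose * (g⁻¹).1.transpose = 1 := by
      rw [← Matrix.transpose_mul, coe_inv_mul_coe, Matrix.transpose_one]
    rw [smul_zero_val, smul_negOne_val, smul_negOne_val, a2, ← lieAct_matAct ht]
    congr 1
    simp only [Matrix.transpose_mul, mul_neg, neg_mul, mul_assoc]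

lemma smul_lie_of_mem_gr_one (g : SL(9, k)) {x y : E8 k} (hx : x ∈ gr (k := k) 1)
    (hy : y ∈ gr (k := k) (-1)) : ⁅g • x, g • y⁆ = g • ⁅x, y⁆ := by
  obtain ⟨a, a0⟩ := lie_mem_gr_zero hx hy
  obtain ⟨b, b0⟩ := lie_mem_gr_zero (smul_mem_gr g hx) (smul_mem_gr g hy)
  obtain ⟨c1, c2⟩ := mem_gr_zero.mp (smul_mem_gr g a)
  obtain ⟨d1, d2⟩ := mem_gr_zero.mp b
  refine ext_val (b0.trans ?_) (congrArg Subtype.val (d1.trans c1.symm))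
    (congrArg Subtype.val (d2.trans c2.symm))
  rw [smul_one_val, smul_negOne_val, smul_zero_val, a0, moment_matAct (coe_inv_mul_coe g)]

end E8

lemma E8.IsHomogeneousSl2Triple.smul [CharZero k] {h e f : E8 k}
    (t : E8.IsHomogeneousSl2Triple h e f) (g : SL(9, k)) :
    E8.IsHomogeneousSl2Triple (g • h) (g • e) (g • f) where
  h_mem := E8.smul_mem_gr g t.h_mem
  e_mem := E8.smul_mem_gr g t.e_mem
  f_mem := E8.smul_mem_gr g t.f_mem
  lie_e_f := by rw [E8.smul_lie_of_mem_gr_one g t.e_mem t.f_mem, t.lie_e_f]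
  lie_h_e := by rw [E8.smul_lie_of_mem_gr_zero g t.h_mem, t.lie_h_e, E8.group_smul_smul]
  lie_h_f := by rw [E8.smul_lie_of_mem_gr_zero g t.h_mem, t.lie_h_f, E8.group_smul_smul]

end GroupAction

/-! ### Conjugacy of homogeneous `𝔰𝔩₂`-triples -/

section Triples

variable {k : Type*} [Field k] [CharZero k]

namespace E8

instance : FiniteDimensional k (E8 k) :=
  Module.Finite.of_surjective
    ({ toFun := fun x => ⟨x.1, x.2.1, x.2.2⟩
       map_add' := fun _ _ => rfl
       map_smul' := fun _ _ => rfl } :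
      LieAlgebra.SpecialLinear.sl (Fin 9) k × Tri k × Tri k →ₗ[k] E8 k)
    fun x => ⟨(x.zero, x.one, x.negOne), rfl⟩

/-- The component in degree `0`, as a linear map to matrices. -/
def zeroLin : E8 k →ₗ[k] Matrix (Fin 9) (Fin 9) k where
  toFun x := x.zero.1
  map_add' _ _ := rfl
  map_smul' _ _ := rfl

variable {h e f : E8 k}

/-- The third element of an `𝔰𝔩₂`-triple is determined by the other two: `ad e` is injective on
vectors of weight `-2`. -/
lemma IsHomogeneousSl2Triple.eq_of_eq {f' : E8 k} (t : IsHomogeneousSl2Triple h e f)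
    (t' : IsHomogeneousSl2Triple h e f') : f = f' := by
  have hh : ⁅h, f - f'⁆ = (-2 : k) • (f - f') := by
    rw [lie_sub, t.lie_h_f, t'.lie_h_f, smul_sub]
  have he : ⁅e, f - f'⁆ = 0 := by rw [lie_sub, t.lie_e_f, t'.lie_e_f, sub_self]
  by_contra hne
  have hne' := sub_ne_zero.mpr hne
  by_cases h0 : h = 0
  · rw [h0, zero_lie] at hh
    exact (smul_ne_zero (by norm_num) hne') hh.symm
  have t2 : IsSl2Triple h e f :=
    { h_ne_zero := h0
      lie_e_f := t.lie_e_f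
      lie_h_e_nsmul := by rw [t.lie_h_e, two_smul, two_nsmul]
      lie_h_f_nsmul := by rw [t.lie_h_f, neg_smul, two_smul, two_nsmul] }
  have P : t2.HasPrimitiveVectorWith (f - f') (-2 : k) := ⟨hne', hh, he⟩
  obtain ⟨n, hn⟩ := P.exists_nat
  have : ((n + 2 : ℕ) : k) = 0 := by push_cast; rw [← hn]; ring
  exact absurd (Nat.cast_eq_zero.mp this) (by omega)

/-- Any two elements `h`, `h'` of `[e, 𝔤₋₁]` with `[h, e] = [h', e] = 2 e`, the first of which
belongs to an `𝔰𝔩₂`-triple, are conjugate under the stabilizer of `e`. -/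
lemma IsHomogeneousSl2Triple.exists_smul_eq (t : IsHomogeneousSl2Triple h e f) {h' y : E8 k}
    (hy : y ∈ gr (k := k) (-1)) (hey : ⁅e, y⁆ = h') (he : ⁅h', e⁆ = (2 : k) • e) :
    ∃ u : SL(9, k), u • e = e ∧ u • h = h' := by
  have h'_mem : h' ∈ gr (k := k) 0 := hey ▸ (lie_mem_gr_zero t.e_mem hy).1
  have hw0 : ⁅e, h' - h⁆ = 0 := by
    rw [lie_sub, ← lie_skew, he, ← lie_skew, t.lie_h_e, sub_self]
  let ad := LieAlgebra.ad k (E8 k)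
  have hEF : ad e * ad f - ad f * ad e = ad h := LinearMap.ext fun x => by
    change ⁅e, ⁅f, x⁆⁆ - ⁅f, ⁅e, x⁆⁆ = ⁅h, x⁆
    rw [← lie_lie, t.lie_e_f]
  have hHE : ad h * ad e - ad e * ad h = (2 : k) • ad e := LinearMap.ext fun x => by
    change ⁅h, ⁅e, x⁆⁆ - ⁅e, ⁅h, x⁆⁆ = (2 : k) • ⁅e, x⁆
    rw [← lie_lie, t.lie_h_e, smul_lie]
  have hHF : ad h * ad f - ad f * ad h = (-2 : k) • ad f := LinearMap.ext fun x => by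
    change ⁅h, ⁅f, x⁆⁆ - ⁅f, ⁅h, x⁆⁆ = (-2 : k) • ⁅f, x⁆
    rw [← lie_lie, t.lie_h_f, smul_lie]
  obtain ⟨n, hn⟩ := exists_aeval_shiftedProd_eq_zero hEF hHE hHF
  have hw : ad e (y - f) = h' - h := by
    rw [LieAlgebra.ad_apply, lie_sub, hey, t.lie_e_f]
  have hker := hn (y - f) (by rw [hw]; exact hw0)
  rw [hw] at hker
  -- the eigenvectors of which `h' - h` is the sum again have degree `0` and commute with `e`
  let p : Submodule k (E8 k) := gr (k := k) 0 ⊓ LinearMap.ker (ad e)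
  have hp : ∀ x ∈ p, ad h x ∈ p := by
    rintro x ⟨hx0, hxe⟩
    obtain ⟨-, b1, b2⟩ := lie_eq_of_mem_gr_zero t.h_mem x
    obtain ⟨x1, x2⟩ := mem_gr_zero.mp hx0
    refine ⟨mem_gr_zero.mpr ⟨Subtype.ext (b1.trans ?_), Subtype.ext (b2.trans ?_)⟩, ?_⟩
    · rw [x1]; simpa using lieAct_smul h.zero.1 (0 : k) 0
    · rw [x2]; simpa using lieAct_smul (-h.zero.1.transpose) (0 : k) 0
    · have hxe' : ⁅e, x⁆ = 0 := hxe
      have heh : ⁅e, h⁆ = -((2 : k) • e) := by rw [← lie_skew, t.lie_h_e]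
      change ⁅e, ⁅h, x⁆⁆ = 0
      rw [leibniz_lie, hxe', heh, neg_lie, smul_lie, hxe']
      simp
  have hmem := mem_iSup_eigenspace_of_aeval_prod_eq_zero hp (Finset.range n)
    (fun j : ℕ => (j : k) + 1) (fun a b hab => Nat.cast_injective (add_right_cancel hab))
    (h' - h) ⟨(gr (k := k) 0).sub_mem h'_mem t.h_mem, hw0⟩ hker
  have hle : (⨆ j ∈ Finset.range n, p ⊓ Module.End.eigenspace (ad h) ((j : k) + 1)) ≤
      (weightAnnGE h.zero.1 e.one.1 1).comap zeroLin := by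
    refine iSup₂_le fun j _ x hx => ?_
    refine weightAnn_le_weightAnnGE h.zero.1 e.one.1 (Nat.le_add_left 1 j) ⟨?_, ?_⟩
    · have hxe : ⁅x, e⁆ = 0 := by
        rw [← lie_skew, neg_eq_zero]; exact hx.1.2
      exact (lie_eq_of_mem_gr_zero hx.1.1 e).2.1.symm.trans
        (congrArg (fun z : E8 k => z.one.1) hxe)
    · have hxh : ⁅h, x⁆ = ((j : k) + 1) • x := Module.End.mem_eigenspace_iff.mp hx.2
      have := (lie_eq_of_mem_gr_zero t.h_mem x).1
      rw [hxh] at this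
      push_cast
      exact this.symm
  obtain ⟨u, hue, huh⟩ := exists_conj_eq_add_of_mem_weightAnnGE h.zero.1 e.one.1 one_pos
    (hle hmem)
  refine ⟨u, ?_, ?_⟩
  · obtain ⟨c1, c2⟩ := mem_gr_one.mp (smul_mem_gr u t.e_mem)
    obtain ⟨d1, d2⟩ := mem_gr_one.mp t.e_mem
    exact E8.ext (c1.trans d1.symm) (Subtype.ext hue) (c2.trans d2.symm)
  · obtain ⟨c1, c2⟩ := mem_gr_zero.mp (smul_mem_gr u t.h_mem)
    obtain ⟨d1, d2⟩ := mem_gr_zero.mp h'_mem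
    refine E8.ext (Subtype.ext ?_) (c1.trans d1.symm) (c2.trans d2.symm)
    rw [smul_zero_val, huh]
    exact add_sub_cancel h.zero.1 h'.zero.1

/-- Two homogeneous `𝔰𝔩₂`-triples with the same `e` are conjugate under the stabilizer of `e`. -/
lemma IsHomogeneousSl2Triple.exists_smul_eq_triple {h' f' : E8 k}
    (t : IsHomogeneousSl2Triple h e f) (t' : IsHomogeneousSl2Triple h' e f') :
    ∃ u : SL(9, k), u • h = h' ∧ u • e = e ∧ u • f = f' := by
  obtain ⟨u, hue, huh⟩ := t.exists_smul_eq t'.f_mem t'.lie_e_f t'.lie_h_e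
  have tu := t.smul u
  rw [hue, huh] at tu
  exact ⟨u, huh, hue, tu.eq_of_eq t'⟩

end E8
end Triples

/-! ### Real structure and the Galois cohomology of `SL(9)` -/

section BaseChange

namespace E8

variable {k K : Type*} [Field k] [Field K] (φ : k →+* K)

lemma map_injective : Function.Injective (map φ) := by
  intro x y h
  refine ext_val ?_ ?_ ?_
  · ext i j
    exact φ.injective (congrFun (congrFun (congrArg (fun z : E8 K => z.zero.1) h) i) j)
  · funext i j l
    exact φ.injective (congrFun (congrFun (congrFun (congrArg (fun z : E8 K => z.one.1) h) i) j) l)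
  · funext i j l
    exact φ.injective
      (congrFun (congrFun (congrFun (congrArg (fun z : E8 K => z.negOne.1) h) i) j) l)

lemma map_smul_scalar (c : k) (x : E8 k) : map φ (c • x) = φ c • map φ x := by
  refine ext_val ?_ ?_ ?_
  · ext i j; exact map_mul φ _ _
  · funext i j l; exact map_mul φ _ _
  · funext i j l; exact map_mul φ _ _

lemma map_zero_iff {x : E8 k} : ((map φ x).zero = 0 ↔ x.zero = 0) ∧
    ((map φ x).one = 0 ↔ x.one = 0) ∧ ((map φ x).negOne = 0 ↔ x.negOne = 0) := by
  refine ⟨⟨fun h => Subtype.ext ?_, fun h => Subtype.ext ?_⟩,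
    ⟨fun h => Subtype.ext ?_, fun h => Subtype.ext ?_⟩,
    ⟨fun h => Subtype.ext ?_, fun h => Subtype.ext ?_⟩⟩
  · ext i j
    exact (map_eq_zero φ).mp (congrFun (congrFun (congrArg Subtype.val h) i) j)
  · ext i j
    exact (map_eq_zero φ).mpr (congrFun (congrFun (congrArg Subtype.val h) i) j)
  · funext i j l
    exact (map_eq_zero φ).mp (congrFun (congrFun (congrFun (congrArg Subtype.val h) i) j) l)
  · funext i j l
    exact (map_eq_zero φ).mpr (congrFun (congrFun (congrFun (congrArg Subtype.val h) i) j) l)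
  · funext i j l
    exact (map_eq_zero φ).mp (congrFun (congrFun (congrFun (congrArg Subtype.val h) i) j) l)
  · funext i j l
    exact (map_eq_zero φ).mpr (congrFun (congrFun (congrFun (congrArg Subtype.val h) i) j) l)

lemma map_lieAct (X : Matrix (Fin 9) (Fin 9) k) (v : Tensor k) :
    (fun i j l => φ (lieAct X v i j l)) = lieAct (X.map φ) fun i j l => φ (v i j l) := by
  funext i j l
  simp [lieAct]

lemma map_cross (v w : Tensor k) :
    (fun i j l => φ (cross v w i j l)) =
      cross (fun i j l => φ (v i j l)) fun i j l => φ (w i j l) := by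
  funext i j l
  simp only [cross, map_mul, map_sum, map_div₀, map_one, map_ofNat, apply_ite φ, map_zero,
    map_intCast]

lemma map_moment (v w : Tensor k) :
    (moment v w).map φ = moment (fun i j l => φ (v i j l)) fun i j l => φ (w i j l) := by
  have hc : (contract v w).map φ =
      contract (fun i j l => φ (v i j l)) fun i j l => φ (w i j l) := by
    ext i j
    simp [contract, map_ofNat φ 2]
  rw [moment, moment, traceless, traceless, ← hc]
  ext i j
  simp [Matrix.trace, Matrix.one_apply, apply_ite φ, map_ofNat φ 9]

variable [CharZero k] [CharZero K]

lemma map_mem_gr {d : ZMod 3} {x : E8 k} : map φ x ∈ gr (k := K) d ↔ x ∈ gr (k := k) d := by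
  obtain ⟨h0, h1, h2⟩ := map_zero_iff φ (x := x)
  exact and_congr (imp_congr_right fun _ => h0)
    (and_congr (imp_congr_right fun _ => h1) (imp_congr_right fun _ => h2))

lemma map_lie (x y : E8 k) : map φ ⁅x, y⁆ = ⁅map φ x, map φ y⁆ := by
  refine ext_val ?_ ?_ ?_
  · change (br0 _ _ _ _ _ _).map φ = br0 (x.zero.1.map φ) (y.zero.1.map φ) _ _ _ _
    simp only [br0]
    rw [Matrix.map_sub _ (map_sub φ), Matrix.map_add _ (map_add φ), Matrix.map_sub _ (map_sub φ),
      Matrix.map_mul, Matrix.map_mul, map_moment, map_moment]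
    rfl
  · have h1 := map_lieAct φ x.zero.1 y.one.1
    have h2 := map_lieAct φ y.zero.1 x.one.1
    have h3 := map_cross φ x.negOne.1 y.negOne.1
    funext i j l
    change φ (lieAct x.zero.1 y.one.1 i j l - lieAct y.zero.1 x.one.1 i j l -
      cross x.negOne.1 y.negOne.1 i j l) = _
    rw [map_sub, map_sub]
    exact congrArg₂ _ (congrArg₂ _ (congrFun (congrFun (congrFun h1 i) j) l)
      (congrFun (congrFun (congrFun h2 i) j) l)) (congrFun (congrFun (congrFun h3 i) j) l)
  · have hm : ∀ A : Matrix (Fin 9) (Fin 9) k, (-A.transpose).map φ = -(A.map φ).transpose :=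
      fun A => by ext i j; exact map_neg φ _
    have h1 := map_lieAct φ (-x.zero.1.transpose) y.negOne.1
    have h2 := map_lieAct φ (-y.zero.1.transpose) x.negOne.1
    have h3 := map_cross φ x.one.1 y.one.1
    rw [hm] at h1 h2
    funext i j l
    change φ (lieAct (-x.zero.1.transpose) y.negOne.1 i j l -
      lieAct (-y.zero.1.transpose) x.negOne.1 i j l + cross x.one.1 y.one.1 i j l) = _
    rw [map_add, map_sub]
    exact congrArg₂ _ (congrArg₂ _ (congrFun (congrFun (congrFun h1 i) j) l)
      (congrFun (congrFun (congrFun h2 i) j) l)) (congrFun (congrFun (congrFun h3 i) j) l)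

lemma isHomogeneousSl2Triple_map {h e f : E8 k} :
    IsHomogeneousSl2Triple (map φ h) (map φ e) (map φ f) ↔ IsHomogeneousSl2Triple h e f := by
  constructor
  · rintro ⟨h1, h2, h3, h4, h5, h6⟩
    rw [← map_lie] at h4 h5 h6
    rw [← map_ofNat φ 2, ← map_smul_scalar] at h5
    rw [← map_ofNat φ 2, ← map_neg φ, ← map_smul_scalar] at h6
    exact ⟨(map_mem_gr φ).mp h1, (map_mem_gr φ).mp h2, (map_mem_gr φ).mp h3, map_injective φ h4,
      map_injective φ h5, map_injective φ h6⟩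
  · rintro ⟨h1, h2, h3, h4, h5, h6⟩
    refine ⟨(map_mem_gr φ).mpr h1, (map_mem_gr φ).mpr h2, (map_mem_gr φ).mpr h3, ?_, ?_, ?_⟩
    · rw [← map_lie, h4]
    · rw [← map_lie, h5, map_smul_scalar, map_ofNat]
    · rw [← map_lie, h6, map_smul_scalar, map_neg, map_ofNat]

/-- The real part of an element of the complex Lie algebra. -/
noncomputable def re (x : E8 ℂ) : E8 ℝ where
  zero := ⟨x.zero.1.map Complex.re, LinearMap.mem_ker.mpr (by
    have h := congrArg Complex.re x.trace_eq_zero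
    rw [Matrix.trace, Complex.re_sum] at h
    exact h)⟩
  one := ⟨fun i j l => (x.one.1 i j l).re, fun i j l =>
    ⟨congrArg Complex.re (x.one.2 i j l).1, congrArg Complex.re (x.one.2 i j l).2⟩⟩
  negOne := ⟨fun i j l => (x.negOne.1 i j l).re, fun i j l =>
    ⟨congrArg Complex.re (x.negOne.2 i j l).1, congrArg Complex.re (x.negOne.2 i j l).2⟩⟩

lemma ofReal_re (x : E8 ℂ) : ofReal (re x) = (1 / 2 : ℂ) • (x + conj x) := by
  have key : ∀ z : ℂ, ((z.re : ℝ) : ℂ) = 1 / 2 * (z + starRingEnd ℂ z) := fun z => by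
    rw [Complex.re_eq_add_conj]; ring
  refine ext_val ?_ ?_ ?_
  · ext i j; exact key _
  · funext i j l; exact key _
  · funext i j l; exact key _

lemma ofReal_re_of_conj_eq {x : E8 ℂ} (hx : conj x = x) : ofReal (re x) = x := by
  rw [ofReal_re, hx, ← two_smul ℂ x, smul_smul]; norm_num

lemma ofReal_injective : Function.Injective ofReal := map_injective _

lemma conj_smul (g : SL(9, ℂ)) (x : E8 ℂ) : conj (g • x) = conjSL g • conj x :=
  map_smul_group _ g x

lemma ofReal_smul (r : SL(9, ℝ)) (x : E8 ℝ) :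
    ofReal (r • x) = Matrix.SpecialLinearGroup.map Complex.ofRealHom r • ofReal x :=
  map_smul_group _ r x

lemma re_mem_gr {d : ZMod 3} {x : E8 ℂ} (hx : x ∈ gr (k := ℂ) d) : re x ∈ gr (k := ℝ) d := by
  rw [← map_mem_gr Complex.ofRealHom]
  change ofReal (re x) ∈ _
  rw [ofReal_re]
  exact Submodule.smul_mem _ _ (Submodule.add_mem _ hx ((map_mem_gr _).mpr hx))

end E8

lemma conjSL_map_ofReal (r : SL(9, ℝ)) :
    conjSL (Matrix.SpecialLinearGroup.map Complex.ofRealHom r) =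
      Matrix.SpecialLinearGroup.map Complex.ofRealHom r := by
  ext i j
  exact Complex.conj_ofReal _

lemma exists_map_ofReal_eq {g : SL(9, ℂ)} (hg : conjSL g = g) :
    ∃ r : SL(9, ℝ), Matrix.SpecialLinearGroup.map Complex.ofRealHom r = g := by
  have hre : (g.1.map Complex.re).map Complex.ofRealHom = g.1 := by
    ext i j
    exact Complex.conj_eq_iff_re.mp (congrFun (congrFun (congrArg Subtype.val hg) i) j)
  refine ⟨⟨g.1.map Complex.re, ?_⟩, Subtype.ext hre⟩
  apply Complex.ofRealHom.injective
  rw [RingHom.map_det, RingHom.mapMatrix_apply, hre, g.2, map_one]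

/-- The first Galois cohomology of `SL(9)` over `ℝ` is trivial. -/
lemma exists_inv_mul_conjSL_eq {c : SL(9, ℂ)} (hc : c * conjSL c = 1) :
    ∃ g : SL(9, ℂ), g⁻¹ * conjSL g = c := by
  -- `A = z + conj z * conj c` satisfies `conj A = A * c`, and it is invertible for almost all `z`
  let C : Matrix (Fin 9) (Fin 9) ℂ := c.1.map (starRingEnd ℂ)
  have hcC : c.1 * C = 1 := congrArg Subtype.val hc
  have hCc : C * c.1 = 1 := mul_eq_one_comm.mp hcC
  have hCconj : C.map (starRingEnd ℂ) = c.1 := by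
    ext i j; exact Complex.conj_conj _
  obtain ⟨z, hz⟩ : ∃ z : ℂ, (z • (1 : Matrix (Fin 9) (Fin 9) ℂ) + starRingEnd ℂ z • C).det ≠ 0 := by
    -- the determinant is a polynomial in `t` for `z = 1 + t * I`, nonzero at `t = -I`
    let p : Polynomial ℂ := Matrix.det
      ((1 + Polynomial.X * Polynomial.C Complex.I) • (1 : Matrix (Fin 9) (Fin 9) (Polynomial ℂ)) +
        (1 - Polynomial.X * Polynomial.C Complex.I) • C.map Polynomial.C)
    have hp : ∀ t : ℂ, p.eval t = ((1 + t * Complex.I) • (1 : Matrix (Fin 9) (Fin 9) ℂ) +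
        (1 - t * Complex.I) • C).det := by
      intro t
      change Polynomial.evalRingHom t p = _
      rw [RingHom.map_det]
      congr 1
      ext i j
      simp [Matrix.one_apply, apply_ite (Polynomial.eval t), mul_comm t]
    have hp0 : p ≠ 0 := by
      intro h0
      have := hp (-Complex.I)
      rw [h0, Polynomial.eval_zero] at this
      have e1 : (1 + -Complex.I * Complex.I : ℂ) = 2 := by
        rw [neg_mul, Complex.I_mul_I]; norm_num
      have e2 : (1 - -Complex.I * Complex.I : ℂ) = 0 := by
        rw [neg_mul, Complex.I_mul_I]; norm_num
      rw [e1, e2, zero_smul, add_zero, Matrix.det_smul, Matrix.det_one] at this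
      norm_num at this
    have hinf : (Set.range fun t : ℝ => (t : ℂ)).Infinite :=
      Set.infinite_range_of_injective Complex.ofReal_injective
    obtain ⟨_, ⟨t, rfl⟩, ht⟩ := hinf.exists_notMem_finset p.roots.toFinset
    refine ⟨1 + t * Complex.I, ?_⟩
    have hconj : starRingEnd ℂ (1 + t * Complex.I) = 1 - t * Complex.I := by
      simp [sub_eq_add_neg]
    rw [hconj, ← hp]
    intro h0
    exact ht (Multiset.mem_toFinset.mpr ((Polynomial.mem_roots hp0).mpr h0))
  set A := z • (1 : Matrix (Fin 9) (Fin 9) ℂ) + starRingEnd ℂ z • C with hA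
  have hAc : A.map (starRingEnd ℂ) = A * c.1 := by
    have : A.map (starRingEnd ℂ) = starRingEnd ℂ z • (1 : Matrix (Fin 9) (Fin 9) ℂ) + z • c.1 := by
      rw [← hCconj]
      ext i j
      simp [hA, Matrix.one_apply, apply_ite (starRingEnd ℂ)]
    rw [this, hA, add_mul, smul_mul_assoc, smul_mul_assoc, hCc, one_mul, add_comm]
  have hdet : starRingEnd ℂ A.det = A.det := by
    rw [RingHom.map_det, RingHom.mapMatrix_apply, hAc, Matrix.det_mul, c.2, mul_one]
  -- the determinant of `A` is real, so dividing the first row by it keeps `conj A = A * c`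
  let D : Matrix (Fin 9) (Fin 9) ℂ := Matrix.diagonal (Function.update 1 0 A.det⁻¹)
  have hD : D.map (starRingEnd ℂ) = D := by
    rw [Matrix.diagonal_map (map_zero _)]
    congr 1
    funext i
    by_cases hi : i = 0
    · subst hi; simp [hdet]
    · simp [hi]
  have hDdet : D.det = A.det⁻¹ := by
    rw [Matrix.det_diagonal, Finset.prod_update_of_mem (Finset.mem_univ _)]
    simp
  let g : SL(9, ℂ) := ⟨D * A, by rw [Matrix.det_mul, hDdet, inv_mul_cancel₀ hz]⟩
  refine ⟨g, inv_mul_eq_iff_eq_mul.mpr (Subtype.ext ?_)⟩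
  change (D * A).map (starRingEnd ℂ) = D * A * c.1
  rw [Matrix.map_mul, hD, hAc, mul_assoc]

end BaseChange

/-! ### Real orbits and cocycles -/

section RealOrbits

variable {h e f : E8 ℝ}

lemma ofReal_triple (t : E8.IsHomogeneousSl2Triple h e f) :
    E8.IsHomogeneousSl2Triple (E8.ofReal h) (E8.ofReal e) (E8.ofReal f) :=
  (E8.isHomogeneousSl2Triple_map _).mpr t

lemma mem_centralizer_iff {g : SL(9, ℂ)} : g ∈ centralizer h e f ↔
    g • E8.ofReal h = E8.ofReal h ∧ g • E8.ofReal e = E8.ofReal e ∧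
      g • E8.ofReal f = E8.ofReal f := by
  simp only [centralizer, Subgroup.mem_inf, MulAction.mem_stabilizer_iff, and_assoc]

/-- If `g⁻¹ * conj g` fixes a real element `x`, then `g • x` is real. -/
lemma ofReal_re_smul {g : SL(9, ℂ)} {x : E8 ℝ}
    (hg : (g⁻¹ * conjSL g) • E8.ofReal x = E8.ofReal x) :
    E8.ofReal (E8.re (g • E8.ofReal x)) = g • E8.ofReal x := by
  apply E8.ofReal_re_of_conj_eq
  rw [E8.conj_smul, E8.conj_ofReal]
  rw [mul_smul, inv_smul_eq_iff] at hg
  exact hg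

/-- A cocycle with values in the stabilizer of the triple twists it into another real triple. -/
lemma re_smul_triple (t : E8.IsHomogeneousSl2Triple h e f) {g : SL(9, ℂ)}
    (hg : g⁻¹ * conjSL g ∈ centralizer h e f) :
    E8.IsHomogeneousSl2Triple (E8.re (g • E8.ofReal h)) (E8.re (g • E8.ofReal e))
      (E8.re (g • E8.ofReal f)) := by
  obtain ⟨h1, h2, h3⟩ := mem_centralizer_iff.mp hg
  refine (E8.isHomogeneousSl2Triple_map Complex.ofRealHom).mp ?_
  change E8.IsHomogeneousSl2Triple (E8.ofReal _) (E8.ofReal _) (E8.ofReal _)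
  rw [ofReal_re_smul h1, ofReal_re_smul h2, ofReal_re_smul h3]
  exact (ofReal_triple t).smul g

lemma re_smul_mem_realPoints (t : E8.IsHomogeneousSl2Triple h e f) {g : SL(9, ℂ)}
    (hg : g⁻¹ * conjSL g ∈ centralizer h e f) : E8.re (g • E8.ofReal e) ∈ realPoints e :=
  ⟨(re_smul_triple t hg).e_mem, by
    rw [ofReal_re_smul (mem_centralizer_iff.mp hg).2.1]; exact MulAction.mem_orbit _ _⟩

/-- Cohomologous cocycles give the same orbit: `g' * a⁻¹ * g⁻¹` is real. -/
lemma orbit_re_smul_eq_of_cohomologous {g g' a : SL(9, ℂ)} (ha : a ∈ centralizer h e f)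
    (hg : g⁻¹ * conjSL g ∈ centralizer h e f) (hg' : g'⁻¹ * conjSL g' ∈ centralizer h e f)
    (hc : g'⁻¹ * conjSL g' = a⁻¹ * (g⁻¹ * conjSL g) * conjSL a) :
    MulAction.orbit SL(9, ℝ) (E8.re (g' • E8.ofReal e)) =
      MulAction.orbit SL(9, ℝ) (E8.re (g • E8.ofReal e)) := by
  have hreal : conjSL (g' * a⁻¹ * g⁻¹) = g' * a⁻¹ * g⁻¹ := by
    rw [map_mul, map_mul, map_inv, map_inv, inv_mul_eq_iff_eq_mul.mp hc]
    group
  obtain ⟨r, hr⟩ := exists_map_ofReal_eq hreal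
  rw [MulAction.orbit_eq_iff]
  refine ⟨r, E8.ofReal_injective ?_⟩
  change E8.ofReal (r • _) = _
  have hae : a⁻¹ • E8.ofReal e = E8.ofReal e := by
    rw [inv_smul_eq_iff, (mem_centralizer_iff.mp ha).2.1]
  rw [E8.ofReal_smul, hr, ofReal_re_smul (mem_centralizer_iff.mp hg).2.1,
    ofReal_re_smul (mem_centralizer_iff.mp hg').2.1, ← mul_smul, inv_mul_cancel_right, mul_smul,
    hae]

/-- Cocycles that give the same orbit are cohomologous. -/
lemma exists_cohomologous_of_orbit_eq (t : E8.IsHomogeneousSl2Triple h e f) {g g' : SL(9, ℂ)}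
    (hg : g⁻¹ * conjSL g ∈ centralizer h e f) (hg' : g'⁻¹ * conjSL g' ∈ centralizer h e f)
    (ho : MulAction.orbit SL(9, ℝ) (E8.re (g • E8.ofReal e)) =
      MulAction.orbit SL(9, ℝ) (E8.re (g' • E8.ofReal e))) :
    ∃ a ∈ centralizer h e f, g'⁻¹ * conjSL g' = a⁻¹ * (g⁻¹ * conjSL g) * conjSL a := by
  obtain ⟨r, hr⟩ := MulAction.orbit_eq_iff.mp ho.symm
  change r • _ = _ at hr
  have t1 := (re_smul_triple t hg).smul r
  have t2 := re_smul_triple t hg'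
  rw [hr] at t1
  -- a real element takes one real triple to the other
  obtain ⟨u, hu1, hu2, hu3⟩ := t1.exists_smul_eq_triple t2
  let s : SL(9, ℂ) := Matrix.SpecialLinearGroup.map Complex.ofRealHom (u * r)
  obtain ⟨b1, b2, b3⟩ := mem_centralizer_iff.mp hg
  obtain ⟨c1, c2, c3⟩ := mem_centralizer_iff.mp hg'
  have hs : ∀ {x : E8 ℝ}, (g⁻¹ * conjSL g) • E8.ofReal x = E8.ofReal x →
      (g'⁻¹ * conjSL g') • E8.ofReal x = E8.ofReal x →
      (u * r) • E8.re (g • E8.ofReal x) = E8.re (g' • E8.ofReal x) →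
      (g'⁻¹ * s * g) • E8.ofReal x = E8.ofReal x := by
    intro x hx hx' hux
    rw [mul_smul, mul_smul, inv_smul_eq_iff, ← ofReal_re_smul hx, ← E8.ofReal_smul, hux,
      ofReal_re_smul hx']
  have ha : g'⁻¹ * s * g ∈ centralizer h e f := mem_centralizer_iff.mpr
    ⟨hs b1 c1 (by rw [mul_smul, hu1]), hs b2 c2 (by rw [mul_smul, hr, hu2]),
      hs b3 c3 (by rw [mul_smul, hu3])⟩
  refine ⟨(g'⁻¹ * s * g)⁻¹, inv_mem ha, ?_⟩
  have hsc : conjSL s = s := conjSL_map_ofReal _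
  rw [map_inv, map_mul, map_mul, map_inv, hsc]
  group

/-- Every real point of the complex orbit of `e` has the form `g • e` with `g⁻¹ * conj g` in the
stabilizer of the triple. If `x = g • e`, then the elements `h'` of `[x, 𝔤₋₁]` with `[h', x] = 2 x`
form an affine space defined over `ℝ`. It contains `g • h`, hence also the real part of `g • h`,
and all of its elements are conjugate under the complex stabilizer of `x`. -/
lemma exists_of_mem_realPoints (t : E8.IsHomogeneousSl2Triple h e f) {x : E8 ℝ}
    (hx : x ∈ realPoints e) :
    ∃ g : SL(9, ℂ), E8.ofReal x = g • E8.ofReal e ∧ g⁻¹ * conjSL g ∈ centralizer h e f := by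
  obtain ⟨hx1, g, hg⟩ := hx
  change g • E8.ofReal e = E8.ofReal x at hg
  have tg := (ofReal_triple t).smul g
  rw [hg] at tg
  have hconjx := E8.conj_ofReal x
  -- the two equations for the real part are averages of those for `g • h` and its conjugate
  have hy : ⁅E8.ofReal x, E8.ofReal (E8.re (g • E8.ofReal f))⁆ =
      E8.ofReal (E8.re (g • E8.ofReal h)) := by
    have hc : ⁅E8.ofReal x, E8.conj (g • E8.ofReal f)⁆ = E8.conj (g • E8.ofReal h) := by
      rw [← tg.lie_e_f]
      conv_lhs => rw [← hconjx]
      exact (E8.map_lie _ _ _).symm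
    rw [E8.ofReal_re, E8.ofReal_re, lie_smul, lie_add, hc, tg.lie_e_f]
  have hz : ⁅E8.ofReal (E8.re (g • E8.ofReal h)), E8.ofReal x⁆ = (2 : ℂ) • E8.ofReal x := by
    have hc : ⁅E8.conj (g • E8.ofReal h), E8.ofReal x⁆ = (2 : ℂ) • E8.ofReal x := by
      have := congrArg E8.conj tg.lie_h_e
      conv_lhs => rw [← hconjx]
      refine (E8.map_lie _ _ _).symm.trans (this.trans ?_)
      refine (E8.map_smul_scalar _ _ _).trans ?_
      rw [map_ofNat]
      exact congrArg _ hconjx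
    rw [E8.ofReal_re, smul_lie, add_lie, hc, tg.lie_h_e]
    module
  obtain ⟨u, hu1, hu2⟩ := tg.exists_smul_eq
    ((E8.map_mem_gr _).mpr (E8.re_mem_gr tg.f_mem)) hy hz
  have hge : (u * g) • E8.ofReal e = E8.ofReal x := by rw [mul_smul, hg, hu1]
  have hgh : (u * g) • E8.ofReal h = E8.ofReal (E8.re (g • E8.ofReal h)) := by rw [mul_smul, hu2]
  have tug := (ofReal_triple t).smul (u * g)
  rw [hge, hgh] at tug
  -- conjugation fixes the first two elements of the new triple, hence also the third
  have hconj : E8.conj ((u * g) • E8.ofReal f) = (u * g) • E8.ofReal f := by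
    have tc := (E8.isHomogeneousSl2Triple_map (starRingEnd ℂ)).mpr tug
    change E8.IsHomogeneousSl2Triple (E8.conj _) (E8.conj _) (E8.conj _) at tc
    rw [E8.conj_ofReal, E8.conj_ofReal] at tc
    exact tc.eq_of_eq tug
  refine ⟨u * g, hge.symm, mem_centralizer_iff.mpr ⟨?_, ?_, ?_⟩⟩
  all_goals
    rw [mul_smul, inv_smul_eq_iff]
  · rw [← E8.conj_ofReal h, ← E8.conj_smul, E8.conj_ofReal, hgh, E8.conj_ofReal]
  · rw [← E8.conj_ofReal e, ← E8.conj_smul, E8.conj_ofReal, hge, E8.conj_ofReal]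
  · rw [← E8.conj_ofReal f, ← E8.conj_smul, E8.conj_ofReal, hconj]

lemma inv_mul_conjSL_mul_conjSL (g : SL(9, ℂ)) :
    (g⁻¹ * conjSL g) * conjSL (g⁻¹ * conjSL g) = 1 := by
  rw [map_mul, conjSL_conjSL, map_inv]
  group

end RealOrbits

end Trivector

open Trivector in
theorem mainTheorem3 (h e f : Trivector.E8 ℝ) (he : e ∈ Trivector.E8.gr (k := ℝ) 1)
    (hnil : IsNilpotent (LieAlgebra.ad ℝ (Trivector.E8 ℝ) e))
    (ht : Trivector.E8.IsHomogeneousSl2Triple h e f) :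
    ∃ Φ : (Trivector.centralizerGamma h e f).H1 ≃ Trivector.realOrbits e,
      ∀ c : (Trivector.centralizerGamma h e f).Z1,
        (∃ g : Matrix.SpecialLinearGroup (Fin 9) ℂ, g⁻¹ * Trivector.conjSL g = c.1) ∧
        ∀ g : Matrix.SpecialLinearGroup (Fin 9) ℂ, g⁻¹ * Trivector.conjSL g = c.1 →
          ∃ x : Trivector.E8 ℝ, Trivector.E8.ofReal x = g • Trivector.E8.ofReal e ∧
            (Φ ((Trivector.centralizerGamma h e f).toH1 c) : Set (Trivector.E8 ℝ)) =
              MulAction.orbit (Matrix.SpecialLinearGroup (Fin 9) ℝ) x := by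
  have hex : ∀ c : (centralizerGamma h e f).Z1, ∃ g : SL(9, ℂ), g⁻¹ * conjSL g = c.1 :=
    fun c => exists_inv_mul_conjSL_eq (congrArg Subtype.val c.2)
  choose G hG using hex
  have hGmem : ∀ c, (G c)⁻¹ * conjSL (G c) ∈ centralizer h e f := fun c => by
    rw [hG]; exact c.1.2
  let Ψ : (centralizerGamma h e f).H1 → realOrbits e :=
    Quotient.lift (s := (centralizerGamma h e f).cohomologous)
      (fun c => ⟨MulAction.orbit SL(9, ℝ) (E8.re (G c • E8.ofReal e)),
        _, re_smul_mem_realPoints ht (hGmem c), rfl⟩)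
      (by
        rintro c c' ⟨a, ha⟩
        refine Subtype.ext (orbit_re_smul_eq_of_cohomologous a.2 (hGmem c) (hGmem c') ?_).symm
        rw [hG, hG]
        exact congrArg Subtype.val ha)
  -- the orbit does not depend on the choice of `g`
  have hΨ : ∀ (c : (centralizerGamma h e f).Z1) (g : SL(9, ℂ)), g⁻¹ * conjSL g = c.1 →
      (Ψ ((centralizerGamma h e f).toH1 c) : Set (E8 ℝ)) =
        MulAction.orbit SL(9, ℝ) (E8.re (g • E8.ofReal e)) := fun c g hg =>
    orbit_re_smul_eq_of_cohomologous (one_mem _) (by rw [hg]; exact c.1.2) (hGmem c)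
      (by rw [hG, hg]; simp)
  have hbij : Function.Bijective Ψ := by
    constructor
    · intro q q'
      induction q using Quotient.inductionOn with | _ c
      induction q' using Quotient.inductionOn with | _ c'
      intro heq
      obtain ⟨a, ha, hac⟩ := exists_cohomologous_of_orbit_eq ht (hGmem c) (hGmem c')
        (congrArg Subtype.val heq)
      rw [hG, hG] at hac
      exact Quotient.sound (s := (centralizerGamma h e f).cohomologous)
        ⟨⟨a, ha⟩, Subtype.ext hac⟩
    · rintro ⟨_, x, hx, rfl⟩
      obtain ⟨g, hgx, hg⟩ := exists_of_mem_realPoints ht hx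
      let c : (centralizerGamma h e f).Z1 :=
        ⟨⟨_, hg⟩, Subtype.ext (inv_mul_conjSL_mul_conjSL g)⟩
      refine ⟨(centralizerGamma h e f).toH1 c, Subtype.ext ((hΨ c g rfl).trans ?_)⟩
      have : E8.re (g • E8.ofReal e) = x := E8.ofReal_injective
        ((ofReal_re_smul (mem_centralizer_iff.mp hg).2.1).trans hgx.symm)
      rw [this]
  refine ⟨Equiv.ofBijective Ψ hbij, fun c => ⟨⟨G c, hG c⟩, fun g hg => ?_⟩⟩
  have hmem : g⁻¹ * conjSL g ∈ centralizer h e f := by rw [hg]; exact c.1.2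
  exact ⟨_, ofReal_re_smul (mem_centralizer_iff.mp hmem).2.1, hΨ c g hg⟩
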